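/- There is an absolute constant $c>0$ such that the following holds. Let $n\ge 2$ and let $X=(X_1,\dots,X_n)$ be a random vector in $\mathbb R^n$ that is isotropic, i.e. its components are uncorrelated with mean zero and variance one, and whose distribution is symmetric about the origin ($X$ and $-X$ have the same law). Let $\Lambda=\Lambda(X)$ be the smallest constant such that $$\operatorname{Var}\Big(\sum_{i,j=1}^n a_{ij}X_iX_j\Big)\le \Lambda\sum_{i,j=1}^n a_{ij}^2\qquad\text{for all real } a_{ij},$$ and assume that $\Lambda<\infty$. For $\theta$ in the unit sphere $S^{n-1}$ and $t\in\mathbb R$ put $f_\theta(t)=\mathbb E\,e^{it\langle X,\theta\rangle}$, let $\mathbb E_\theta$ denote integration over $\theta$ with respect to the uniform probability measure on $S^{n-1}$, and let $f(t)=\mathbb E_\theta f_\theta(t)$. Then, for all $t$ with $0<|t|\le n^{1/6}$, $$\mathbb E_\theta\,|f_\theta(t)-f(t)|^2\le \frac{c}{n^2}\,\Lambda t^4$$ and $$\mathbb E_\theta\exp\Big\{\frac{n}{c\,\Lambda t^2}\,|f_\theta(t)-f(t)|\Big\}\le 2 .$$ -/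

import Mathlib

open MeasureTheory ProbabilityTheory
open scoped ENNReal

noncomputable section

namespace WeightedSums

/-- The uniform probability measure on the unit sphere of `ℝⁿ`: the normalized surface measure. -/
def sphereUniform (n : ℕ) : Measure (Metric.sphere (0 : EuclideanSpace ℝ (Fin n)) 1) :=
  ((volume : Measure (EuclideanSpace ℝ (Fin n))).toSphere Set.univ)⁻¹ •
    (volume : Measure (EuclideanSpace ℝ (Fin n))).toSphere

variable {n : ℕ} {Ω : Type*} [MeasurableSpace Ω]

/-- The random vector `X` is isotropic: its components are square integrable and uncorrelated,
with mean zero and variance one. -/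
structure IsIsotropic (X : Ω → EuclideanSpace ℝ (Fin n)) (P : Measure Ω) : Prop where
  memLp : ∀ i, MemLp (fun ω => X ω i) 2 P
  mean_eq_zero : ∀ i, ∫ ω, X ω i ∂P = 0
  variance_eq_one : ∀ i, variance (fun ω => X ω i) P = 1
  uncorrelated : ∀ i j, i ≠ j → covariance (fun ω => X ω i) (fun ω => X ω j) P = 0

/-- The second order correlation condition with constant `L`. The variance is the extended one,
which is infinite for a random variable that is not square integrable. -/
def SecondOrderCorrelation (X : Ω → EuclideanSpace ℝ (Fin n)) (P : Measure Ω) (L : ℝ≥0∞) : Prop :=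
  ∀ a : Fin n → Fin n → ℝ,
    evariance (fun ω => ∑ i, ∑ j, a i j * X ω i * X ω j) P
      ≤ L * ENNReal.ofReal (∑ i, ∑ j, a i j ^ 2)

/-- `Λ(X)`: the optimal (possibly infinite) constant in the second order correlation condition. -/
def corrConst (X : Ω → EuclideanSpace ℝ (Fin n)) (P : Measure Ω) : ℝ≥0∞ :=
  sInf {L | SecondOrderCorrelation X P L}

/-- `f_θ(t) = E exp(i t ⟨X, θ⟩)`, the characteristic function of `S_θ = ⟨X, θ⟩`. -/
def weightedCharFun (X : Ω → EuclideanSpace ℝ (Fin n)) (P : Measure Ω)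
    (θ : EuclideanSpace ℝ (Fin n)) (t : ℝ) : ℂ :=
  ∫ ω, Complex.exp (Complex.I * (t : ℂ) * ((inner ℝ (X ω) θ : ℝ) : ℂ)) ∂P

/-- `f(t)`, the average of `f_θ(t)` over `θ` uniform on the unit sphere. -/
def meanCharFun (X : Ω → EuclideanSpace ℝ (Fin n)) (P : Measure Ω) (t : ℝ) : ℂ :=
  ∫ θ, weightedCharFun X P (θ : EuclideanSpace ℝ (Fin n)) t ∂(sphereUniform n)

end WeightedSums

end

/-! Symmetry makes `f_θ(t)` real, equal to the cosine transform of the law `μ` of `X` at `t θ`. With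
`s = t / √n`, a standard Gaussian point has norm close to `√n`, so the plan is to prove
concentration for the cosine transform at frequency `s` under the Gaussian measure and then pass to
the sphere.

The function studied is `defect`, the cosine transform of `μ` minus that of the standard Gaussian.
The subtracted term is radial, hence invisible on the sphere. Its role is to correct the Hessian:
the cosine transform alone has Hessian `-s² E[y_i y_j cos]`, whose identity part has Hilbert-Schmidt
norm of order `√n`. After subtraction that part carries only the small factor `defect`. The centred
part is bounded by duality with the second order correlation condition
(`sum_sq_integral_quad_cos_le`), so the squared Hilbert-Schmidt norm is `O(s⁴ (L + n · defect² +
1))`, where `L = Λ`.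

The Gaussian Poincaré inequality is used twice. The gradient is odd, so its components have mean
zero and its second moment is bounded by that of the Hessian; the resulting term `n E defect²` is
absorbed when `s⁴ n` is small (`integral_norm_sq_defectGrad_le`). This yields variance `O(s⁴ L)`,
that is, `O(L t⁴ / n²)`. For exponential moments, the Maurey-Pisier inequality bounds those of
`defect` by those of its squared gradient. The gradient norm is itself `O(s²)`-Lipschitz, because
isotropy alone bounds the operator norm of the Hessian, so it has Gaussian tails.

In polar coordinates the Gaussian splits into independent radius and direction. Jensen's inequality
transfers moments to the radial average, and replacing that average by the value at radius `√n`
costs only `O(s²)`. If `t⁴ / n` is not small, the restriction `|t| ≤ n^{1/6}` bounds `n` by a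
constant and a trivial estimate suffices. -/

namespace WeightedSums

/-! ### Maurey-Pisier inequality and exponential moments of Gaussian linear forms. -/

section Gaussian

open Real

/-- Jensen's inequality along the rotation path joining two points. -/
lemma convex_sub_le_integral_rotation {E : Type*} [NormedAddCommGroup E]
    [InnerProductSpace ℝ E] {T : E → ℝ} {g : E → E}
    (hT : ∀ x, HasFDerivAt T (innerSL ℝ (g x)) x) (hg : Continuous g)
    {Φ : ℝ → ℝ} (hΦ : ConvexOn ℝ Set.univ Φ) (hΦc : Continuous Φ) (p : E × E) :
    Φ (T p.2 - T p.1) ≤ ∫ u in (0 : ℝ)..1,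
      Φ (π / 2 * inner ℝ (g (ContinuousLinearMap.rotation (π / 2 * u) p).1)
        (ContinuousLinearMap.rotation (π / 2 * u) p).2) := by
  set k : ℝ → ℝ := fun u => π / 2 * inner ℝ (g (ContinuousLinearMap.rotation (π / 2 * u) p).1)
        (ContinuousLinearMap.rotation (π / 2 * u) p).2 with hk
  have hrot : Continuous fun u : ℝ => ContinuousLinearMap.rotation (π / 2 * u) p := by
    simp only [ContinuousLinearMap.rotation_apply]
    fun_prop
  have hkc : Continuous k := by
    exact continuous_const.mul ((hg.comp hrot.fst).inner hrot.snd)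
  -- The path runs from `p.1` at `u = 0` to `p.2` at `u = 1`. It is the first component of the
  -- rotated pair, and its velocity is `π / 2` times the second component.
  have hpath : ∀ u : ℝ, HasDerivAt
      (fun u : ℝ => cos (π / 2 * u) • p.1 + sin (π / 2 * u) • p.2)
      ((π / 2) • (-sin (π / 2 * u) • p.1 + cos (π / 2 * u) • p.2)) u := by
    intro u
    have h0 : HasDerivAt (fun u : ℝ => π / 2 * u) (π / 2) u := by
      simpa using (hasDerivAt_id u).const_mul (π / 2)
    exact ((h0.cos.smul_const p.1).fun_add (h0.sin.smul_const p.2)).congr_deriv (by module)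
  have hder : ∀ u : ℝ, HasDerivAt
      (fun u : ℝ => T (cos (π / 2 * u) • p.1 + sin (π / 2 * u) • p.2)) (k u) u := by
    intro u
    refine ((hT (cos (π / 2 * u) • p.1 + sin (π / 2 * u) • p.2)).comp_hasDerivAt u
      (hpath u)).congr_deriv ?_
    simp only [hk, ContinuousLinearMap.rotation_apply, innerSL_apply_apply, inner_smul_right]
  have hFTC : T p.2 - T p.1 = ∫ u in (0 : ℝ)..1, k u := by
    rw [intervalIntegral.integral_eq_sub_of_hasDerivAt (fun u _ => hder u)
      (hkc.intervalIntegrable _ _)]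
    simp
  rw [hFTC, intervalIntegral.integral_of_le zero_le_one, intervalIntegral.integral_of_le zero_le_one]
  have : IsProbabilityMeasure (volume.restrict (Set.Ioc (0 : ℝ) 1)) := ⟨by simp⟩
  exact hΦ.map_integral_le hΦc.continuousOn isClosed_univ (by simp)
    ((hkc.intervalIntegrable 0 1).1) (((hΦc.comp hkc).intervalIntegrable 0 1).1)

variable {E : Type*} [NormedAddCommGroup E] [InnerProductSpace ℝ E] [FiniteDimensional ℝ E]
  [MeasurableSpace E] [BorelSpace E]

lemma map_rotation_stdGaussian (θ : ℝ) :
    ((stdGaussian E).prod (stdGaussian E)).map (ContinuousLinearMap.rotation θ) =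
      (stdGaussian E).prod (stdGaussian E) :=
  IsGaussian.map_rotation_eq_self (by simp) θ

/-- The Maurey-Pisier inequality for the standard Gaussian measure. -/
theorem lintegral_convex_sub_le {T : E → ℝ} {g : E → E}
    (hT : ∀ x, HasFDerivAt T (innerSL ℝ (g x)) x) (hg : Continuous g)
    {Φ : ℝ → ℝ} (hΦ : ConvexOn ℝ Set.univ Φ) (hΦ0 : ∀ x, 0 ≤ Φ x) :
    ∫⁻ p, ENNReal.ofReal (Φ (T p.2 - T p.1)) ∂((stdGaussian E).prod (stdGaussian E)) ≤
      ∫⁻ p, ENNReal.ofReal (Φ (π / 2 * inner ℝ (g p.1) p.2))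
        ∂((stdGaussian E).prod (stdGaussian E)) := by
  have hΦc : Continuous Φ := by
    simpa [continuousOn_univ] using hΦ.continuousOn isOpen_univ
  set k : E × E → ℝ≥0∞ := fun p => ENNReal.ofReal (Φ (π / 2 * inner ℝ (g p.1) p.2)) with hk
  have hkc : Continuous k := by
    refine ENNReal.continuous_ofReal.comp (hΦc.comp ?_)
    have h1 := hg.comp (continuous_fst : Continuous fun p : E × E => p.1)
    fun_prop
  calc ∫⁻ p, ENNReal.ofReal (Φ (T p.2 - T p.1)) ∂((stdGaussian E).prod (stdGaussian E))
      ≤ ∫⁻ p, (∫⁻ u in Set.Ioc (0 : ℝ) 1, k (ContinuousLinearMap.rotation (π / 2 * u) p))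
        ∂((stdGaussian E).prod (stdGaussian E)) := by
        refine lintegral_mono fun p => ?_
        refine (ENNReal.ofReal_le_ofReal
          (convex_sub_le_integral_rotation hT hg hΦ hΦc p)).trans_eq ?_
        rw [intervalIntegral.integral_of_le zero_le_one, ofReal_integral_eq_lintegral_ofReal]
        · have hrot : Continuous fun u : ℝ => ContinuousLinearMap.rotation (π / 2 * u) p := by
            simp only [ContinuousLinearMap.rotation_apply]
            fun_prop
          exact (Continuous.intervalIntegrable (hΦc.comp (continuous_const.mul
            ((hg.comp hrot.fst).inner hrot.snd))) 0 1).1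
        · exact ae_of_all _ fun u => hΦ0 _
    _ = ∫⁻ u in Set.Ioc (0 : ℝ) 1, ∫⁻ p, k (ContinuousLinearMap.rotation (π / 2 * u) p)
        ∂((stdGaussian E).prod (stdGaussian E)) := by
        refine lintegral_lintegral_swap (Measurable.aemeasurable ?_)
        have hrot : Continuous fun q : (E × E) × ℝ =>
            ContinuousLinearMap.rotation (π / 2 * q.2) q.1 := by
          simp only [ContinuousLinearMap.rotation_apply]
          fun_prop
        exact (hkc.comp hrot).measurable
    _ = ∫⁻ u in Set.Ioc (0 : ℝ) 1, ∫⁻ p, k p ∂((stdGaussian E).prod (stdGaussian E)) := by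
        -- The product Gaussian is rotation invariant, so every `u` contributes the same integral.
        refine lintegral_congr fun u => ?_
        conv_rhs => rw [← map_rotation_stdGaussian (E := E) (π / 2 * u)]
        rw [lintegral_map hkc.measurable (by fun_prop)]
    _ = _ := by simp [hk]

lemma map_inner_stdGaussian (w : E) :
    (stdGaussian E).map (fun y => inner ℝ w y) = gaussianReal 0 (‖w‖₊ ^ 2) := by
  have h := IsGaussian.map_eq_gaussianReal (μ := stdGaussian E) (innerSL ℝ w)
  rw [integral_strongDual_stdGaussian, variance_dual_stdGaussian] at h
  simp only [innerSL_apply_norm] at h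
  rw [show (‖w‖₊ ^ 2 : NNReal) = (‖w‖ ^ 2).toNNReal by
    ext; simp [Real.coe_toNNReal _ (sq_nonneg ‖w‖)]]
  simpa using h

lemma integral_inner_sq_stdGaussian (w : E) :
    ∫ y, inner ℝ w y ^ 2 ∂(stdGaussian E) = ‖w‖ ^ 2 := by
  have h := variance_dual_stdGaussian (innerSL ℝ w : StrongDual ℝ E)
  rw [variance_of_integral_eq_zero (by fun_prop)
    (integral_strongDual_stdGaussian (innerSL ℝ w))] at h
  simpa using h

lemma integrable_inner_sq_stdGaussian (w : E) :
    Integrable (fun y => inner ℝ w y ^ 2) (stdGaussian E) := by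
  have := (IsGaussian.memLp_dual (stdGaussian E) (innerSL ℝ w) 2 (by simp)).integrable_sq
  simpa using this

lemma lintegral_exp_inner_stdGaussian (w : E) :
    ∫⁻ y, ENNReal.ofReal (exp (inner ℝ w y)) ∂(stdGaussian E) =
      ENNReal.ofReal (exp (‖w‖ ^ 2 / 2)) := by
  have h1 : ∫⁻ z, ENNReal.ofReal (exp z) ∂(gaussianReal 0 (‖w‖₊ ^ 2)) =
      ENNReal.ofReal (exp (‖w‖ ^ 2 / 2)) := by
    have h2 := integrable_exp_mul_gaussianReal (μ := 0) (v := ‖w‖₊ ^ 2) 1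
    have h3 := congrFun (mgf_id_gaussianReal (μ := 0) (v := ‖w‖₊ ^ 2)) 1
    simp only [mgf, one_mul, id] at h2 h3
    rw [← ofReal_integral_eq_lintegral_ofReal h2 (ae_of_all _ fun _ => (exp_pos _).le), h3]
    simp
  rw [← h1, ← map_inner_stdGaussian, lintegral_map (by fun_prop) (by fun_prop)]

/-- For nonzero `w` the integral is `(1 - 2 a ‖w‖²)^(-1/2)`, and `3 / 8` is exactly the threshold at
which this equals `2`. -/
lemma lintegral_exp_inner_sq_stdGaussian_le (w : E) {a : ℝ}
    (haw : a * ‖w‖ ^ 2 ≤ 3 / 8) :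
    ∫⁻ y, ENNReal.ofReal (exp (a * inner ℝ w y ^ 2)) ∂(stdGaussian E) ≤ 2 := by
  by_cases hw : w = 0
  · simp [hw]
  have hw' : 0 < ‖w‖ := norm_pos_iff.2 hw
  set v := ‖w‖₊ ^ 2 with hv
  have hv0 : v ≠ 0 := by simpa [hv] using hw
  have hvr : (v : ℝ) = ‖w‖ ^ 2 := by simp [hv]
  have hvp : 0 < (v : ℝ) := by rw [hvr]; positivity
  have h1 : ∫⁻ z, ENNReal.ofReal (exp (a * z ^ 2)) ∂(gaussianReal 0 v) ≤ 2 := by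
    rw [gaussianReal_of_var_ne_zero _ hv0, lintegral_withDensity_eq_lintegral_mul _
      (measurable_gaussianPDF _ _) (by fun_prop)]
    have hb : 0 < 1 / (2 * (v : ℝ)) - a := by
      rw [sub_pos, lt_div_iff₀ (by positivity), hvr]; linarith
    have h2 : ∀ z, (gaussianPDF 0 v * fun z => ENNReal.ofReal (exp (a * z ^ 2))) z =
        ENNReal.ofReal ((√(2 * π * v))⁻¹ * exp (-(1 / (2 * (v : ℝ)) - a) * z ^ 2)) := by
      intro z
      simp only [Pi.mul_apply, gaussianPDF, gaussianPDFReal_def]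
      rw [← ENNReal.ofReal_mul (by positivity), mul_assoc, ← exp_add]
      congr 3
      field_simp
      ring
    rw [lintegral_congr h2, ← ofReal_integral_eq_lintegral_ofReal
      ((integrable_exp_neg_mul_sq hb).const_mul _) (ae_of_all _ fun _ => by positivity),
      integral_const_mul, integral_gaussian]
    rw [show (2 : ℝ≥0∞) = ENNReal.ofReal 2 by simp]
    apply ENNReal.ofReal_le_ofReal
    rw [inv_mul_le_iff₀ (by positivity)]
    rw [show √(2 * π * v) * 2 = √(2 * π * v * 4) by
      rw [sqrt_mul (by positivity) 4, show (4 : ℝ) = 2 ^ 2 by norm_num, sqrt_sq (by norm_num)]]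
    apply sqrt_le_sqrt
    rw [div_le_iff₀ hb]
    have : 2 * π * v * 4 * (1 / (2 * (v : ℝ)) - a) = π * (4 - 8 * (a * v)) := by
      field_simp
      ring
    rw [this, hvr]
    nlinarith [pi_pos]
  rw [← map_inner_stdGaussian, lintegral_map (by fun_prop) (by fun_prop)] at h1
  exact h1

end Gaussian

end WeightedSums

namespace WeightedSums

/-! ### Poincaré and exponential inequalities for the Gaussian measure. -/

section GaussianConcentration

open Real

variable {E : Type*} [NormedAddCommGroup E] [InnerProductSpace ℝ E] [FiniteDimensional ℝ E]
  [MeasurableSpace E] [BorelSpace E]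

/-- The Maurey-Pisier inequality for deviations from the mean. -/
theorem lintegral_convex_sub_mean_le {T : E → ℝ} {g : E → E}
    (hT : ∀ x, HasFDerivAt T (innerSL ℝ (g x)) x) (hg : Continuous g)
    {Φ : ℝ → ℝ} (hΦ : ConvexOn ℝ Set.univ Φ) (hΦ0 : ∀ x, 0 ≤ Φ x)
    (hTi : Integrable T (stdGaussian E))
    (hΦi : ∀ y, Integrable (fun x => Φ (T y - T x)) (stdGaussian E)) :
    ∫⁻ y, ENNReal.ofReal (Φ (T y - ∫ x, T x ∂(stdGaussian E))) ∂(stdGaussian E) ≤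
      ∫⁻ x, ∫⁻ y, ENNReal.ofReal (Φ (inner ℝ ((π / 2) • g x) y))
        ∂(stdGaussian E) ∂(stdGaussian E) := by
  have hΦc : Continuous Φ := by
    simpa [continuousOn_univ] using hΦ.continuousOn isOpen_univ
  have hTc : Continuous T := continuous_iff_continuousAt.2 fun x => (hT x).continuousAt
  calc ∫⁻ y, ENNReal.ofReal (Φ (T y - ∫ x, T x ∂(stdGaussian E))) ∂(stdGaussian E)
      ≤ ∫⁻ y, ∫⁻ x, ENNReal.ofReal (Φ (T y - T x)) ∂(stdGaussian E) ∂(stdGaussian E) := by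
        refine lintegral_mono fun y => ?_
        rw [← ofReal_integral_eq_lintegral_ofReal (hΦi y) (ae_of_all _ fun _ => hΦ0 _)]
        apply ENNReal.ofReal_le_ofReal
        have h := hΦ.map_integral_le (μ := stdGaussian E) (f := fun x => T y - T x)
          hΦc.continuousOn isClosed_univ (by simp) ((integrable_const _).sub hTi) (hΦi y)
        rwa [integral_sub (integrable_const _) hTi, integral_const, probReal_univ, one_smul] at h
    _ = ∫⁻ p, ENNReal.ofReal (Φ (T p.2 - T p.1)) ∂((stdGaussian E).prod (stdGaussian E)) := by
        rw [lintegral_prod_symm]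
        exact Measurable.aemeasurable (by fun_prop)
    _ ≤ _ := lintegral_convex_sub_le hT hg hΦ hΦ0
    _ = _ := by
        rw [lintegral_prod]
        · simp_rw [inner_smul_left]; simp
        · have h1 := hg.comp (continuous_fst : Continuous fun p : E × E => p.1)
          exact (ENNReal.continuous_ofReal.comp (hΦc.comp
            (continuous_const.mul (h1.inner continuous_snd)))).measurable.aemeasurable

/-- A Poincaré inequality for the standard Gaussian measure. -/
theorem integral_sub_mean_sq_le {T : E → ℝ} {g : E → E}
    (hT : ∀ x, HasFDerivAt T (innerSL ℝ (g x)) x) (hg : Continuous g)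
    (hTi : MemLp T 2 (stdGaussian E)) (hgi : Integrable (fun x => ‖g x‖ ^ 2) (stdGaussian E)) :
    ∫ y, (T y - ∫ x, T x ∂(stdGaussian E)) ^ 2 ∂(stdGaussian E) ≤
      π ^ 2 / 4 * ∫ x, ‖g x‖ ^ 2 ∂(stdGaussian E) := by
  have hTi1 := hTi.integrable (q := 2) (by norm_num)
  -- Integrating out the second Gaussian leaves `(π / 2)² ‖g x‖²`. The constant `π² / 4` replaces
  -- the sharp value `1`, which only affects the final constant.
  have h := lintegral_convex_sub_mean_le hT hg (Φ := fun y => y ^ 2)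
    (Even.convexOn_pow even_two) (fun x => sq_nonneg x) hTi1
    (fun y => ((memLp_const (T y)).sub hTi).integrable_sq)
  have h2 : ∀ x, ∫⁻ y, ENNReal.ofReal (inner ℝ ((π / 2) • g x) y ^ 2) ∂(stdGaussian E) =
      ENNReal.ofReal (π ^ 2 / 4 * ‖g x‖ ^ 2) := by
    intro x
    rw [← ofReal_integral_eq_lintegral_ofReal (integrable_inner_sq_stdGaussian _)
      (ae_of_all _ fun _ => sq_nonneg _), integral_inner_sq_stdGaussian, norm_smul, mul_pow]
    congr 2
    rw [norm_eq_abs, sq_abs]; ring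
  rw [lintegral_congr h2, ← ofReal_integral_eq_lintegral_ofReal (hgi.const_mul _)
    (ae_of_all _ fun _ => by positivity), ← ofReal_integral_eq_lintegral_ofReal
    (f := fun y => (T y - ∫ x, T x ∂(stdGaussian E)) ^ 2)
    ((hTi.sub (memLp_const _)).integrable_sq) (ae_of_all _ fun _ => sq_nonneg _),
    ENNReal.ofReal_le_ofReal_iff (integral_nonneg fun _ => by positivity), integral_const_mul] at h
  exact h

/-- Given `x`, the variable `⟨(π / 2) g x, y⟩` is a centred Gaussian of variance `(π / 2)² ‖g x‖²`,
so its exponential moment is explicit. No Lipschitz bound is needed: the estimate passes the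
question to the gradient. Boundedness of `T` only serves integrability. -/
theorem lintegral_exp_sub_mean_le {T : E → ℝ} {g : E → E}
    (hT : ∀ x, HasFDerivAt T (innerSL ℝ (g x)) x) (hg : Continuous g)
    {B : ℝ} (hTB : ∀ x, |T x| ≤ B) (l : ℝ) :
    ∫⁻ y, ENNReal.ofReal (exp (l * (T y - ∫ x, T x ∂(stdGaussian E)))) ∂(stdGaussian E) ≤
      ∫⁻ x, ENNReal.ofReal (exp (π ^ 2 * l ^ 2 / 8 * ‖g x‖ ^ 2)) ∂(stdGaussian E) := by
  have hTc : Continuous T := continuous_iff_continuousAt.2 fun x => (hT x).continuousAt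
  have hTi : Integrable T (stdGaussian E) :=
    .of_bound hTc.aestronglyMeasurable B (ae_of_all _ hTB)
  have hconv : ConvexOn ℝ Set.univ fun y : ℝ => exp (l * y) := by
    have := convexOn_exp.comp_linearMap (l • LinearMap.id (R := ℝ) (M := ℝ))
    simpa [Function.comp_def] using this
  have h := lintegral_convex_sub_mean_le hT hg hconv (fun x => (exp_pos _).le) hTi
    (fun y => .of_bound (by fun_prop) (exp (|l| * (2 * B))) (ae_of_all _ fun x => by
      rw [norm_eq_abs, abs_exp, exp_le_exp]
      calc l * (T y - T x) ≤ |l * (T y - T x)| := le_abs_self _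
        _ = |l| * |T y - T x| := abs_mul _ _
        _ ≤ |l| * (2 * B) := by
          gcongr
          have := abs_sub (T y) (T x)
          linarith [hTB y, hTB x]))
  refine h.trans_eq (lintegral_congr fun x => ?_)
  have := lintegral_exp_inner_stdGaussian (l • (π / 2) • g x)
  simp only [real_inner_smul_left _ _ l] at this
  rw [this, norm_smul, norm_smul, norm_eq_abs, norm_eq_abs, mul_pow, mul_pow, sq_abs, sq_abs]
  congr 2
  ring

lemma convexOn_exp_const_mul_sq {a : ℝ} (ha : 0 ≤ a) :
    ConvexOn ℝ Set.univ fun y : ℝ => exp (a * y ^ 2) := by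
  have h1 : ConvexOn ℝ Set.univ fun y : ℝ => a * y ^ 2 := by
    simpa using (Even.convexOn_pow (𝕜 := ℝ) even_two).smul ha
  refine ⟨convex_univ, fun x _ y _ p q hp hq hpq => ?_⟩
  exact (exp_le_exp.2 (h1.2 (Set.mem_univ x) (Set.mem_univ y) hp hq hpq)).trans
    (convexOn_exp.2 (Set.mem_univ _) (Set.mem_univ _) hp hq hpq)

/-- Sub-Gaussian tails for Lipschitz functions: `⟨(π / 2) g x, y⟩` is conditionally Gaussian with
variance at most `(π / 2)² K²`. This is applied later to a regularised gradient norm. -/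
theorem lintegral_exp_sub_mean_sq_le {T : E → ℝ} {g : E → E}
    (hT : ∀ x, HasFDerivAt T (innerSL ℝ (g x)) x) (hg : Continuous g)
    {B : ℝ} (hTB : ∀ x, |T x| ≤ B) {K a : ℝ} (hK : ∀ x, ‖g x‖ ≤ K) (ha : 0 ≤ a)
    (haK : a * (π ^ 2 / 4 * K ^ 2) ≤ 3 / 8) :
    ∫⁻ y, ENNReal.ofReal (exp (a * (T y - ∫ x, T x ∂(stdGaussian E)) ^ 2)) ∂(stdGaussian E) ≤
      2 := by
  have hTc : Continuous T := continuous_iff_continuousAt.2 fun x => (hT x).continuousAt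
  have hTi : Integrable T (stdGaussian E) :=
    .of_bound hTc.aestronglyMeasurable B (ae_of_all _ hTB)
  have h := lintegral_convex_sub_mean_le hT hg (convexOn_exp_const_mul_sq ha)
    (fun x => (exp_pos _).le) hTi
    (fun y => .of_bound (by fun_prop) (exp (a * (2 * B) ^ 2)) (ae_of_all _ fun x => by
      rw [norm_eq_abs, abs_exp, exp_le_exp]
      gcongr 1
      rw [← sq_abs]
      gcongr
      have := abs_sub (T y) (T x)
      linarith [hTB y, hTB x]))
  refine h.trans ?_
  calc _ ≤ ∫⁻ _ : E, 2 ∂(stdGaussian E) := by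
        refine lintegral_mono fun x => lintegral_exp_inner_sq_stdGaussian_le _ ?_
        refine le_trans ?_ haK
        rw [norm_smul, mul_pow, norm_eq_abs, sq_abs]
        gcongr a * ?_
        rw [div_pow]
        norm_num
        gcongr
        exact hK x
    _ = 2 := by simp

lemma integral_norm_sq_stdGaussian (n : ℕ) :
    ∫ x, ‖x‖ ^ 2 ∂(stdGaussian (EuclideanSpace ℝ (Fin n))) = n := by
  simp_rw [EuclideanSpace.real_norm_sq_eq]
  have h : ∀ i : Fin n, ∀ x : EuclideanSpace ℝ (Fin n),
      x i = inner ℝ (EuclideanSpace.single i (1 : ℝ)) x := by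
    intro i x; simp [EuclideanSpace.inner_single_left]
  rw [integral_finsetSum]
  · simp_rw [fun i x => h i x, integral_inner_sq_stdGaussian]
    simp
  · intro i _
    simp_rw [fun x => h i x]
    exact integrable_inner_sq_stdGaussian _

lemma hasFDerivAt_norm_sq_innerSL {E : Type*} [NormedAddCommGroup E] [InnerProductSpace ℝ E]
    (x : E) :
    HasFDerivAt (fun x : E => ‖x‖ ^ 2) (innerSL ℝ ((2 : ℝ) • x)) x := by
  convert (hasStrictFDerivAt_norm_sq x).hasFDerivAt using 1
  ext y; simp

lemma integrable_norm_pow_stdGaussian (k : ℕ) :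
    Integrable (fun x => ‖x‖ ^ k) (stdGaussian E) := by
  have := (IsGaussian.memLp_id (stdGaussian E) k (by simp)).integrable_norm_pow'
  simpa using this

/-- Poincaré for `‖x‖²`, whose gradient is `2 x`: the bound is `π² n ≤ 10 n`. -/
lemma integral_norm_sq_sub_sq_stdGaussian_le (n : ℕ) :
    ∫ x, (‖x‖ ^ 2 - n) ^ 2 ∂(stdGaussian (EuclideanSpace ℝ (Fin n))) ≤ 10 * n := by
  have h := integral_sub_mean_sq_le (T := fun x : EuclideanSpace ℝ (Fin n) => ‖x‖ ^ 2)
    (g := fun x => (2 : ℝ) • x) hasFDerivAt_norm_sq_innerSL (by fun_prop) ?_ ?_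
  · rw [integral_norm_sq_stdGaussian] at h
    refine h.trans ?_
    simp_rw [norm_smul, mul_pow]
    rw [integral_const_mul, integral_norm_sq_stdGaussian]
    norm_num
    have : π ^ 2 ≤ 10 := by nlinarith [pi_lt_d2, pi_pos]
    have hn : (0 : ℝ) ≤ n := by positivity
    nlinarith
  · rw [memLp_two_iff_integrable_sq (by fun_prop)]
    simpa [← pow_mul] using integrable_norm_pow_stdGaussian 4
  · simp_rw [norm_smul, mul_pow]
    exact (integrable_norm_pow_stdGaussian 2).const_mul _

end GaussianConcentration

end WeightedSums

namespace WeightedSums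

/-! ### Differentiation of cosine integrals. -/

section CosineTransform

open Real

lemma inner_integral_smul {E : Type*} [NormedAddCommGroup E] [InnerProductSpace ℝ E]
    [FiniteDimensional ℝ E] [MeasurableSpace E] {μ : Measure E} {k : E → ℝ} (hk : Integrable (fun y => k y • y) μ) (v : E) :
    inner ℝ (∫ y, k y • y ∂μ) v = ∫ y, k y * inner ℝ y v ∂μ := by
  have h := (innerSL ℝ v).integral_comp_comm hk
  simp only [innerSL_apply_apply, inner_smul_right] at h
  rw [real_inner_comm, ← h]
  simp_rw [real_inner_comm v]

variable {E : Type*} [NormedAddCommGroup E] [InnerProductSpace ℝ E] [FiniteDimensional ℝ E]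
  [MeasurableSpace E] [BorelSpace E] {μ : Measure E}

/-- The weight `Y` and the phase `c` let the same statements serve two orders of differentiation. `Y
= 1`, `c = 0` gives the gradient of the cosine transform; `Y = -s y_i`, `c = -π / 2` exchanges sine
and cosine and gives the gradient of a partial derivative. -/
lemma continuous_integral_sin_smul {Y : E → ℝ} (hY : Measurable Y)
    (hYi : Integrable (fun y => |Y y| * ‖y‖) μ) (s c : ℝ) :
    Continuous fun x => ∫ y, (-(s * Y y * sin (s * inner ℝ y x + c))) • y ∂μ := by
  refine continuous_of_dominated (bound := fun y => |s| * (|Y y| * ‖y‖)) (fun x => ?_)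
    (fun x => ae_of_all _ fun y => ?_) (hYi.const_mul _) (ae_of_all _ fun y => by fun_prop)
  · exact (Measurable.smul (by fun_prop) measurable_id).aestronglyMeasurable
  · rw [norm_smul, norm_neg, norm_mul, norm_mul, norm_eq_abs, norm_eq_abs, norm_eq_abs]
    calc |s| * |Y y| * |sin (s * inner ℝ y x + c)| * ‖y‖ ≤ |s| * |Y y| * 1 * ‖y‖ := by
          gcongr; exact abs_sin_le_one _
      _ = _ := by ring

lemma hasFDerivAt_integral_mul_cos {Y : E → ℝ} (hY : Measurable Y) (hY1 : Integrable Y μ)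
    (hYi : Integrable (fun y => |Y y| * ‖y‖) μ) (s c : ℝ) (x : E) :
    HasFDerivAt (fun x => ∫ y, Y y * cos (s * inner ℝ y x + c) ∂μ)
      (innerSL ℝ (∫ y, (-(s * Y y * sin (s * inner ℝ y x + c))) • y ∂μ)) x := by
  have hm : ∀ x : E, AEStronglyMeasurable
      (fun y => (-(s * Y y * sin (s * inner ℝ y x + c))) • y) μ := fun x =>
    (Measurable.smul (by fun_prop) measurable_id).aestronglyMeasurable
  have hb : ∀ x y : E, ‖(-(s * Y y * sin (s * inner ℝ y x + c))) • y‖ ≤ |s| * (|Y y| * ‖y‖) := by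
    intro x y
    rw [norm_smul, norm_neg, norm_mul, norm_mul, norm_eq_abs, norm_eq_abs, norm_eq_abs]
    calc |s| * |Y y| * |sin (s * inner ℝ y x + c)| * ‖y‖ ≤ |s| * |Y y| * 1 * ‖y‖ := by
          gcongr; exact abs_sin_le_one _
      _ = _ := by ring
  have hi : Integrable (fun y => (-(s * Y y * sin (s * inner ℝ y x + c))) • y) μ :=
    (hYi.const_mul |s|).mono' (hm x) (ae_of_all _ (hb x))
  have h := hasFDerivAt_integral_of_dominated_of_fderiv_le (𝕜 := ℝ) (μ := μ) (x₀ := x)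
    (s := Set.univ) (F := fun x y => Y y * cos (s * inner ℝ y x + c))
    (F' := fun x y => innerSL ℝ ((-(s * Y y * sin (s * inner ℝ y x + c))) • y))
    (bound := fun y => |s| * (|Y y| * ‖y‖)) Filter.univ_mem
    (Filter.Eventually.of_forall fun x => Measurable.aestronglyMeasurable (by fun_prop))
    (hY1.norm.mono' (Measurable.aestronglyMeasurable (by fun_prop)) (ae_of_all _ fun y => by
      rw [norm_mul]
      exact mul_le_of_le_one_right (norm_nonneg _) (abs_cos_le_one _)))
    ((innerSL ℝ).continuous.comp_aestronglyMeasurable (hm x))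
    (ae_of_all _ fun y x _ => by rw [innerSL_apply_norm]; exact hb x y)
    (hYi.const_mul _)
    (ae_of_all _ fun y x _ => by
      have h1 : HasFDerivAt (fun x => s * inner ℝ y x + c) (s • innerSL ℝ y) x :=
        (((innerSL ℝ y).hasFDerivAt).const_mul s).add_const c
      refine (h1.cos.const_mul (Y y)).congr_fderiv ?_
      ext v
      simp only [smul_apply, innerSL_apply_apply, inner_smul_left, smul_eq_mul,
        RCLike.conj_to_real]
      ring)
  rwa [(innerSL ℝ (E := E)).integral_comp_comm hi] at h

end CosineTransform

/-! ### Elementary inequalities for exponentials and trigonometric functions. -/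

section Estimates

open Real

lemma mul_exp_neg_half_le_one {z : ℝ} (hz : 0 ≤ z) : z * exp (-(z / 2)) ≤ 1 := by
  rw [exp_neg, ← div_eq_mul_inv, div_le_one (exp_pos _)]
  have := quadratic_le_exp_of_nonneg (show 0 ≤ z / 2 by linarith)
  nlinarith [sq_nonneg (z - 2)]

/-- For `x ≥ y`, use a tangent bound and `y exp (-y) ≤ 1`; for `x ≤ y`, use the chord of the
exponential over `[-y, 0]`. The right side is invariant under scaling `x` and `y` together, which
later removes all dependence on `s`. -/
lemma abs_exp_neg_sub_exp_neg_le {x y : ℝ} (hx : 0 ≤ x) (hy : 0 < y) :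
    |exp (-x) - exp (-y)| ≤ |x - y| / y := by
  have key : y * exp (-y) ≤ 1 := by
    rw [exp_neg, ← div_eq_mul_inv, div_le_one (exp_pos _)]
    linarith [add_one_le_exp y]
  rcases le_total y x with h | h
  · rw [abs_sub_comm, abs_of_nonneg (sub_nonneg.2 (exp_le_exp.2 (by linarith))),
      abs_of_nonneg (by linarith), le_div_iff₀ hy]
    have h1 : exp (-x) = exp (-y) * exp (-(x - y)) := by rw [← exp_add]; ring_nf
    have h2 := one_sub_le_exp_neg (x - y)
    rw [h1]
    have h3 := exp_pos (-y)
    have h4 : exp (-y) - exp (-y) * exp (-(x - y)) ≤ exp (-y) * (x - y) := by nlinarith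
    calc _ ≤ exp (-y) * (x - y) * y := by gcongr
      _ = (y * exp (-y)) * (x - y) := by ring
      _ ≤ 1 * (x - y) := by gcongr
      _ = _ := one_mul _
  · rw [abs_of_nonneg (sub_nonneg.2 (exp_le_exp.2 (by linarith))), abs_sub_comm,
      abs_of_nonneg (by linarith)]
    have hc := convexOn_exp.2 (Set.mem_univ 0) (Set.mem_univ (-y))
      (show 0 ≤ (y - x) / y from div_nonneg (by linarith) hy.le)
      (show 0 ≤ x / y by positivity) (by field_simp; simp)
    have h5 : ((y - x) / y) • (0 : ℝ) + (x / y) • (-y) = -x := by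
      simp only [smul_eq_mul]; field_simp; simp
    rw [h5] at hc
    simp only [smul_eq_mul, exp_zero, mul_one] at hc
    have h6 : x / y * exp (-y) ≤ exp (-y) :=
      mul_le_of_le_one_left (exp_pos _).le ((div_le_one hy).2 h)
    linarith

lemma abs_sub_sin_le_sq (h : ℝ) : |h - sin h| ≤ h ^ 2 := by
  wlog h0 : 0 ≤ h generalizing h
  · have := this (-h) (by linarith)
    rwa [sin_neg, sub_neg_eq_add, neg_add_eq_sub, abs_sub_comm, neg_sq] at this
  rw [abs_of_nonneg (sub_nonneg.2 (sin_le h0))]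
  rcases le_or_gt h 1 with h1 | h1
  · rcases h0.eq_or_lt with rfl | h0
    · simp
    · have := sin_gt_sub_cube h0
      nlinarith [sq_nonneg h]
  · rcases le_or_gt h 3 with h3 | h3
    · have := sin_nonneg_of_nonneg_of_le_pi h0 (by linarith [pi_gt_three])
      nlinarith
    · nlinarith [neg_one_le_sin h]

/-- Second order Taylor bound for the cosine. -/
lemma abs_cos_add_sub_le (y h : ℝ) : |cos (y + h) - cos y + h * sin y| ≤ 2 * h ^ 2 := by
  have h1 : cos (y + h) - cos y + h * sin y = -(cos y * (1 - cos h)) + sin y * (h - sin h) := by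
    rw [cos_add]; ring
  have h2 := one_sub_sq_div_two_le_cos (x := h)
  have h3 := abs_sub_sin_le_sq h
  have h4 : |cos y * (1 - cos h)| ≤ 1 * (h ^ 2 / 2) := by
    rw [abs_mul, abs_of_nonneg (sub_nonneg.2 (cos_le_one h))]
    exact mul_le_mul (abs_cos_le_one y) (by linarith) (by linarith [cos_le_one h]) zero_le_one
  have h5 : |sin y * (h - sin h)| ≤ 1 * h ^ 2 := by
    rw [abs_mul]
    exact mul_le_mul (abs_sin_le_one y) h3 (abs_nonneg _) zero_le_one
  rw [h1]
  refine (abs_add_le _ _).trans ?_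
  rw [abs_neg]
  nlinarith [sq_nonneg h]

end Estimates

end WeightedSums

namespace WeightedSums

/-! ### The defect from the Gaussian transform, with its gradient and Hessian. -/

section CosTransform

open Real

variable {n : ℕ}

/-- Isotropy together with the second order correlation condition, in `L¹` form, for a law on
Euclidean space. -/
structure IsSecondOrderIsotropic (μ : Measure (EuclideanSpace ℝ (Fin n))) (L : ℝ) : Prop where
  integrable_norm_sq : Integrable (fun y => ‖y‖ ^ 2) μ
  integral_inner_sq : ∀ v, ∫ y, inner ℝ y v ^ 2 ∂μ = ‖v‖ ^ 2
  integral_abs_quad_le : ∀ a : Fin n → Fin n → ℝ,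
    ∫ y, |∑ i, ∑ j, a i j * y i * y j - ∑ i, a i i| ∂μ ≤ √(L * ∑ i, ∑ j, a i j ^ 2)
  one_le : 1 ≤ L

/-- The real part of the characteristic function of `μ` at `s • x`. -/
noncomputable def cosTransform (μ : Measure (EuclideanSpace ℝ (Fin n))) (s : ℝ)
    (x : EuclideanSpace ℝ (Fin n)) : ℝ :=
  ∫ y, cos (s * inner ℝ y x) ∂μ

/-- The centered Gaussian function with the covariance of an isotropic law. -/
noncomputable def gaussTransform (s : ℝ) (x : EuclideanSpace ℝ (Fin n)) : ℝ := exp (-(s ^ 2 * ‖x‖ ^ 2 / 2))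

/-- The subtracted term is radial, so it does not change deviations on the sphere, and it cancels
the large identity part of the Hessian. -/
noncomputable def defect (μ : Measure (EuclideanSpace ℝ (Fin n))) (s : ℝ) (x : EuclideanSpace ℝ (Fin n)) : ℝ :=
  cosTransform μ s x - gaussTransform s x

noncomputable def defectGrad (μ : Measure (EuclideanSpace ℝ (Fin n))) (s : ℝ) (x : EuclideanSpace ℝ (Fin n)) :
    EuclideanSpace ℝ (Fin n) :=
  (∫ y, (-(s * sin (s * inner ℝ y x))) • y ∂μ) + (s ^ 2 * gaussTransform s x) • x

/-- The rows of the Hessian of `defect μ s`. -/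
noncomputable def defectHess (μ : Measure (EuclideanSpace ℝ (Fin n))) (s : ℝ) (i : Fin n)
    (x : EuclideanSpace ℝ (Fin n)) : EuclideanSpace ℝ (Fin n) :=
  (∫ y, (-(s ^ 2 * y i * cos (s * inner ℝ y x))) • y ∂μ) +
    ((s ^ 2 * gaussTransform s x) • EuclideanSpace.single i (1 : ℝ) -
      (s ^ 4 * x i * gaussTransform s x) • x)

variable {μ : Measure (EuclideanSpace ℝ (Fin n))} {L : ℝ} {s : ℝ}

lemma gaussTransform_pos (x : EuclideanSpace ℝ (Fin n)) : 0 < gaussTransform s x := exp_pos _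

lemma gaussTransform_le_one (x : EuclideanSpace ℝ (Fin n)) : gaussTransform s x ≤ 1 := by
  rw [gaussTransform, exp_le_one_iff]
  have : 0 ≤ s ^ 2 * ‖x‖ ^ 2 / 2 := by positivity
  linarith

lemma sq_mul_norm_sq_mul_gaussTransform_le (x : EuclideanSpace ℝ (Fin n)) :
    s ^ 2 * ‖x‖ ^ 2 * gaussTransform s x ≤ 1 :=
  mul_exp_neg_half_le_one (by positivity)

lemma continuous_gaussTransform : Continuous (gaussTransform (n := n) s) := by
  unfold gaussTransform; fun_prop

lemma hasFDerivAt_gaussTransform (x : EuclideanSpace ℝ (Fin n)) :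
    HasFDerivAt (gaussTransform s) (innerSL ℝ (-(s ^ 2 * gaussTransform s x) • x)) x := by
  have h := (((hasFDerivAt_norm_sq_innerSL x).const_mul (s ^ 2)).mul_const (2⁻¹)).fun_neg.exp
  refine (h.congr_fderiv ?_).congr_of_eventuallyEq (Filter.Eventually.of_forall fun x => ?_)
  · ext v
    simp [gaussTransform, div_eq_mul_inv]
    ring
  · simp [gaussTransform, div_eq_mul_inv]

lemma integrable_bdd_mul {Ω : Type*} [MeasurableSpace Ω] {P : Measure Ω} {f k : Ω → ℝ}
    (hf : Integrable f P) (hk : AEStronglyMeasurable k P) (hk1 : ∀ y, |k y| ≤ 1) :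
    Integrable (fun y => f y * k y) P :=
  hf.mono (hf.1.mul hk) (ae_of_all _ fun y => by
    rw [norm_mul]; exact mul_le_of_le_one_right (norm_nonneg _) (hk1 y))

lemma abs_cosTransform_le [IsProbabilityMeasure μ] (x : EuclideanSpace ℝ (Fin n)) :
    |cosTransform μ s x| ≤ 1 := by
  have := norm_integral_le_of_norm_le_const (μ := μ)
    (f := fun y => cos (s * inner ℝ y x)) (C := 1) (ae_of_all _ fun y => abs_cos_le_one _)
  simpa [cosTransform] using this

lemma abs_defect_le [IsProbabilityMeasure μ] (x : EuclideanSpace ℝ (Fin n)) :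
    |defect μ s x| ≤ 2 := by
  have h1 := abs_cosTransform_le (μ := μ) (s := s) x
  have h2 := gaussTransform_pos (s := s) x
  have h3 := gaussTransform_le_one (s := s) x
  rw [abs_le] at *
  unfold defect
  constructor <;> linarith

/-- Oddness gives the gradient Gaussian mean zero, which is what permits a second use of Poincaré.
-/
lemma defectGrad_neg (x : EuclideanSpace ℝ (Fin n)) :
    defectGrad μ s (-x) = -defectGrad μ s x := by
  simp only [defectGrad, gaussTransform, norm_neg, inner_neg_right, mul_neg, sin_neg, neg_neg,
    smul_neg, neg_add, ← integral_neg, neg_smul]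

namespace IsSecondOrderIsotropic

variable (hμ : IsSecondOrderIsotropic μ L)
include hμ

lemma integrable_inner_mul_inner (v w : EuclideanSpace ℝ (Fin n)) :
    Integrable (fun y => inner ℝ y v * inner ℝ y w) μ := by
  refine (hμ.integrable_norm_sq.mul_const (‖v‖ * ‖w‖)).mono' (by fun_prop)
    (ae_of_all _ fun y => ?_)
  rw [norm_mul]
  calc ‖(inner ℝ y v : ℝ)‖ * ‖(inner ℝ y w : ℝ)‖ ≤ (‖y‖ * ‖v‖) * (‖y‖ * ‖w‖) := by
        gcongr <;> exact norm_inner_le_norm _ _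
    _ = _ := by ring

lemma integrable_coord_mul_coord (i j : Fin n) : Integrable (fun y => y i * y j) μ := by
  have := hμ.integrable_inner_mul_inner (EuclideanSpace.single i 1) (EuclideanSpace.single j 1)
  simpa [EuclideanSpace.inner_single_right] using this

lemma integral_abs_inner_mul_inner_le (v w : EuclideanSpace ℝ (Fin n)) :
    ∫ y, |inner ℝ y v * inner ℝ y w| ∂μ ≤ ‖v‖ * ‖w‖ := by
  wlog h : v ≠ 0 ∧ w ≠ 0
  · by_cases hv : v = 0
    · simp [hv]
    · simp [show w = 0 by tauto]
  have hv := norm_pos_iff.2 h.1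
  have hw := norm_pos_iff.2 h.2
  have hsq : ∀ u : EuclideanSpace ℝ (Fin n), Integrable (fun y => inner ℝ y u ^ 2) μ := fun u => by
    simpa [sq] using hμ.integrable_inner_mul_inner u u
  have hpt : ∀ y : EuclideanSpace ℝ (Fin n), |inner ℝ y v * inner ℝ y w| ≤
      ‖w‖ / (2 * ‖v‖) * inner ℝ y v ^ 2 + ‖v‖ / (2 * ‖w‖) * inner ℝ y w ^ 2 := by
    intro y
    have h0 : ‖w‖ / (2 * ‖v‖) * inner ℝ y v ^ 2 + ‖v‖ / (2 * ‖w‖) * inner ℝ y w ^ 2 =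
        (‖w‖ ^ 2 * |inner ℝ y v| ^ 2 + ‖v‖ ^ 2 * |inner ℝ y w| ^ 2) / (2 * ‖v‖ * ‖w‖) := by
      rw [sq_abs, sq_abs]; field_simp
    rw [h0, le_div_iff₀ (by positivity), abs_mul]
    nlinarith [sq_nonneg (‖w‖ * |inner ℝ y v| - ‖v‖ * |inner ℝ y w|)]
  calc ∫ y, |inner ℝ y v * inner ℝ y w| ∂μ
      ≤ ∫ y, (‖w‖ / (2 * ‖v‖) * inner ℝ y v ^ 2 + ‖v‖ / (2 * ‖w‖) * inner ℝ y w ^ 2) ∂μ :=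
        integral_mono (hμ.integrable_inner_mul_inner v w).abs
          (((hsq v).const_mul _).add ((hsq w).const_mul _)) hpt
    _ = ‖v‖ * ‖w‖ := by
        rw [integral_add ((hsq v).const_mul _) ((hsq w).const_mul _), integral_const_mul,
          integral_const_mul, hμ.integral_inner_sq, hμ.integral_inner_sq]
        field_simp
        ring

lemma integrable_coord_mul_norm (i : Fin n) (c : ℝ) :
    Integrable (fun y => |c * y i| * ‖y‖) μ := by
  refine (hμ.integrable_norm_sq.const_mul |c|).mono' (by fun_prop) (ae_of_all _ fun y => ?_)
  rw [norm_mul, abs_mul, norm_norm, norm_mul, norm_eq_abs, norm_eq_abs, abs_abs, abs_abs]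
  have := PiLp.norm_apply_le y i
  rw [norm_eq_abs] at this
  calc |c| * |y i| * ‖y‖ ≤ |c| * ‖y‖ * ‖y‖ := by gcongr
    _ = _ := by ring

lemma integrable_coord_cos_smul (i : Fin n) (x : EuclideanSpace ℝ (Fin n)) :
    Integrable (fun y => (-(s ^ 2 * y i * cos (s * inner ℝ y x))) • y) μ := by
  refine (hμ.integrable_coord_mul_norm i (s ^ 2)).mono'
    (Measurable.aestronglyMeasurable (by fun_prop)) (ae_of_all _ fun y => ?_)
  rw [norm_smul, norm_neg, norm_mul, norm_eq_abs, norm_eq_abs]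
  gcongr
  exact mul_le_of_le_one_right (abs_nonneg _) (abs_cos_le_one _)

lemma continuous_defectHess (i : Fin n) : Continuous (defectHess μ s i) := by
  have h := continuous_integral_sin_smul (μ := μ) (Y := fun y => -s * y i) (by fun_prop)
    (hμ.integrable_coord_mul_norm i (-s)) s (-(π / 2))
  have h1 : (fun x => ∫ y, (-(s ^ 2 * y i * cos (s * inner ℝ y x))) • y ∂μ) =
      fun x => ∫ y, (-(s * (-s * y i) * sin (s * inner ℝ y x + -(π / 2)))) • y ∂μ := by
    ext1 x
    refine integral_congr_ae (ae_of_all _ fun y => ?_)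
    simp only [← sub_eq_add_neg, sin_sub_pi_div_two]
    congr 1
    ring
  rw [← h1] at h
  have := continuous_gaussTransform (n := n) (s := s)
  unfold defectHess
  fun_prop

lemma inner_defectHess (i : Fin n) (x v : EuclideanSpace ℝ (Fin n)) :
    inner ℝ (defectHess μ s i x) v =
      -s ^ 2 * ∫ y, y i * inner ℝ y v * cos (s * inner ℝ y x) ∂μ +
        s ^ 2 * gaussTransform s x * v i - s ^ 4 * x i * gaussTransform s x * inner ℝ x v := by
  rw [defectHess, inner_add_left, inner_sub_left,
    inner_integral_smul (hμ.integrable_coord_cos_smul i x), ← integral_const_mul,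
    real_inner_smul_left, real_inner_smul_left, EuclideanSpace.inner_single_left]
  simp only [map_one, one_mul]
  rw [← add_sub_assoc]
  congr 2
  refine integral_congr_ae (ae_of_all _ fun y => ?_)
  ring

lemma inner_sum_defectHess (w x v : EuclideanSpace ℝ (Fin n)) :
    inner ℝ (∑ i, w i • defectHess μ s i x) v =
      -s ^ 2 * ∫ y, inner ℝ y w * inner ℝ y v * cos (s * inner ℝ y x) ∂μ +
        s ^ 2 * gaussTransform s x * inner ℝ w v -
        s ^ 4 * inner ℝ x w * gaussTransform s x * inner ℝ x v := by
  have hi : ∀ i ∈ Finset.univ, Integrable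
      (fun y => w i * (y i * inner ℝ y v * cos (s * inner ℝ y x))) μ := by
    intro i _
    have h := hμ.integrable_inner_mul_inner (EuclideanSpace.single i 1) v
    simp only [EuclideanSpace.inner_single_right, one_mul] at h
    exact (integrable_bdd_mul h (by fun_prop) fun y => abs_cos_le_one _).const_mul _
  have h1 : ∫ y, inner ℝ y w * inner ℝ y v * cos (s * inner ℝ y x) ∂μ =
      ∑ i, w i * ∫ y, y i * inner ℝ y v * cos (s * inner ℝ y x) ∂μ := by
    simp_rw [← integral_const_mul]
    rw [← integral_finsetSum _ hi]
    refine integral_congr_ae (ae_of_all _ fun y => ?_)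
    have : inner ℝ y w = ∑ i, w i * y i := by simp [PiLp.inner_apply]
    simp only [this, Finset.sum_mul, mul_assoc]
  have h2 : (inner ℝ w v : ℝ) = ∑ i, w i * v i := by simp [PiLp.inner_apply, mul_comm]
  have h3 : (inner ℝ x w : ℝ) = ∑ i, w i * x i := by simp [PiLp.inner_apply]
  rw [sum_inner, h1, h2, h3]
  simp_rw [real_inner_smul_left, hμ.inner_defectHess, Finset.mul_sum, Finset.sum_mul]
  rw [← Finset.sum_add_distrib, ← Finset.sum_sub_distrib]
  refine Finset.sum_congr rfl fun i _ => ?_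
  ring

/-- The operator norm of the Hessian is at most `3 s²`. -/
lemma norm_sum_defectHess_le (w x : EuclideanSpace ℝ (Fin n)) :
    ‖∑ i, w i • defectHess μ s i x‖ ≤ 3 * s ^ 2 * ‖w‖ := by
  -- Pair the image `v` of `w` with itself. The law of `y`, the Gaussian diagonal and the Gaussian
  -- rank-one term each contribute at most `s² ‖w‖ ‖v‖`.
  set v := ∑ i, w i • defectHess μ s i x with hv
  have h := hμ.inner_sum_defectHess (s := s) w x v
  rw [← hv, real_inner_self_eq_norm_sq] at h
  have h1 : |∫ y, inner ℝ y w * inner ℝ y v * cos (s * inner ℝ y x) ∂μ| ≤ ‖w‖ * ‖v‖ := by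
    refine le_trans ?_ (hμ.integral_abs_inner_mul_inner_le w v)
    refine (abs_integral_le_integral_abs).trans ?_
    have hi := hμ.integrable_inner_mul_inner w v
    refine integral_mono (integrable_bdd_mul hi (by fun_prop) fun y => abs_cos_le_one _).abs
      hi.abs fun y => ?_
    simp only [abs_mul _ (cos _)]
    exact mul_le_of_le_one_right (abs_nonneg _) (abs_cos_le_one _)
  have h2 : |(inner ℝ w v : ℝ)| ≤ ‖w‖ * ‖v‖ := abs_real_inner_le_norm _ _
  have h3 : |inner ℝ x w * inner ℝ x v| ≤ ‖x‖ ^ 2 * (‖w‖ * ‖v‖) := by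
    rw [abs_mul]
    calc _ ≤ (‖x‖ * ‖w‖) * (‖x‖ * ‖v‖) := by
          gcongr <;> exact abs_real_inner_le_norm _ _
      _ = _ := by ring
  have hg0 := gaussTransform_pos (s := s) x
  have hg1 := gaussTransform_le_one (s := s) x
  have hg2 := sq_mul_norm_sq_mul_gaussTransform_le (s := s) x
  have hwv : 0 ≤ ‖w‖ * ‖v‖ := by positivity
  have e1 : gaussTransform s x * inner ℝ w v ≤ ‖w‖ * ‖v‖ := by
    nlinarith [abs_le.1 h2]
  have e2 : -(s ^ 2 * (inner ℝ x w * inner ℝ x v) * gaussTransform s x) ≤ ‖w‖ * ‖v‖ := by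
    calc -(s ^ 2 * (inner ℝ x w * inner ℝ x v) * gaussTransform s x)
        = s ^ 2 * (-(inner ℝ x w * inner ℝ x v)) * gaussTransform s x := by ring
      _ ≤ s ^ 2 * (‖x‖ ^ 2 * (‖w‖ * ‖v‖)) * gaussTransform s x := by
          gcongr; linarith [(abs_le.1 h3).1]
      _ = (s ^ 2 * ‖x‖ ^ 2 * gaussTransform s x) * (‖w‖ * ‖v‖) := by ring
      _ ≤ 1 * (‖w‖ * ‖v‖) := by gcongr
      _ = _ := one_mul _
  have e3 := (abs_le.1 h1).1
  have hs : 0 ≤ s ^ 2 := sq_nonneg s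
  have h4 : ‖v‖ ^ 2 ≤ 3 * s ^ 2 * ‖w‖ * ‖v‖ := by
    rw [h]
    calc _ = s ^ 2 * (-(∫ y, inner ℝ y w * inner ℝ y v * cos (s * inner ℝ y x) ∂μ) +
          gaussTransform s x * inner ℝ w v +
          -(s ^ 2 * (inner ℝ x w * inner ℝ x v) * gaussTransform s x)) := by ring
      _ ≤ s ^ 2 * (‖w‖ * ‖v‖ + ‖w‖ * ‖v‖ + ‖w‖ * ‖v‖) := by gcongr; linarith
      _ = _ := by ring
  rcases (norm_nonneg v).eq_or_lt with h0 | h0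
  · rw [← h0]; positivity
  · rw [sq] at h4
    exact le_of_mul_le_mul_right h4 h0

variable [IsProbabilityMeasure μ]

lemma integrable_norm : Integrable (fun y => ‖y‖) μ := by
  have h : MemLp (fun y : EuclideanSpace ℝ (Fin n) => ‖y‖) 2 μ :=
    (memLp_two_iff_integrable_sq (by fun_prop)).2 hμ.integrable_norm_sq
  exact h.integrable (by norm_num)

lemma hasFDerivAt_defect (x : EuclideanSpace ℝ (Fin n)) :
    HasFDerivAt (defect μ s) (innerSL ℝ (defectGrad μ s x)) x := by
  have h := (hasFDerivAt_integral_mul_cos (μ := μ) (Y := fun _ => 1) (by fun_prop)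
    (by fun_prop) (by simpa using hμ.integrable_norm) s 0 x).fun_sub
      (hasFDerivAt_gaussTransform (s := s) x)
  simp only [one_mul, add_zero, mul_one] at h
  refine h.congr_fderiv ?_
  rw [← map_sub, defectGrad, neg_smul, sub_neg_eq_add]

lemma continuous_defectGrad : Continuous (defectGrad μ s) := by
  have h := continuous_integral_sin_smul (μ := μ) (Y := fun _ => 1) (by fun_prop)
    (by simpa using hμ.integrable_norm) s 0
  simp only [add_zero, mul_one] at h
  have := continuous_gaussTransform (n := n) (s := s)
  unfold defectGrad
  fun_prop

lemma continuous_defect : Continuous (defect μ s) :=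
  continuous_iff_continuousAt.2 fun x => (hμ.hasFDerivAt_defect x).continuousAt

lemma integrable_coord (i : Fin n) : Integrable (fun y => y i) μ :=
  hμ.integrable_norm.mono' (by fun_prop) (ae_of_all _ fun y => PiLp.norm_apply_le y i)

lemma integrable_sin_smul (x : EuclideanSpace ℝ (Fin n)) :
    Integrable (fun y => (-(s * sin (s * inner ℝ y x))) • y) μ := by
  refine (hμ.integrable_norm.const_mul |s|).mono'
    (Measurable.aestronglyMeasurable (by fun_prop)) (ae_of_all _ fun y => ?_)
  rw [norm_smul, norm_neg, norm_mul, norm_eq_abs, norm_eq_abs]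
  calc |s| * |sin (s * inner ℝ y x)| * ‖y‖ ≤ |s| * 1 * ‖y‖ := by
        gcongr; exact abs_sin_le_one _
    _ = _ := by ring

lemma defectGrad_apply (i : Fin n) (x : EuclideanSpace ℝ (Fin n)) :
    defectGrad μ s x i = ∫ y, (-s * y i) * cos (s * inner ℝ y x + -(π / 2)) ∂μ +
      s ^ 2 * gaussTransform s x * x i := by
  have h := inner_integral_smul (hμ.integrable_sin_smul (s := s) x) (EuclideanSpace.single i 1)
  simp only [EuclideanSpace.inner_single_right, one_mul] at h
  simp only [defectGrad, PiLp.add_apply, PiLp.smul_apply, smul_eq_mul]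
  congr 1
  simp only [RCLike.conj_to_real] at h
  rw [h]
  refine integral_congr_ae (ae_of_all _ fun y => ?_)
  simp only [← sub_eq_add_neg, cos_sub_pi_div_two]
  ring

lemma hasFDerivAt_defectGrad_apply (i : Fin n) (x : EuclideanSpace ℝ (Fin n)) :
    HasFDerivAt (fun x => defectGrad μ s x i) (innerSL ℝ (defectHess μ s i x)) x := by
  have h1 := hasFDerivAt_integral_mul_cos (μ := μ) (Y := fun y => -s * y i) (by fun_prop)
    ((hμ.integrable_coord i).const_mul _) (hμ.integrable_coord_mul_norm i (-s)) s (-(π / 2)) x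
  have h2 : HasFDerivAt (fun x : EuclideanSpace ℝ (Fin n) => x i)
      (innerSL ℝ (EuclideanSpace.single i (1 : ℝ))) x := by
    have := (innerSL ℝ (EuclideanSpace.single i (1 : ℝ))).hasFDerivAt (x := x)
    simpa [Function.comp_def, EuclideanSpace.inner_single_left] using this
  have h3 := h1.fun_add (((hasFDerivAt_gaussTransform (s := s) x).const_mul (s ^ 2)).fun_mul h2)
  refine (h3.congr_fderiv ?_).congr_of_eventuallyEq
    (Filter.Eventually.of_forall fun x => hμ.defectGrad_apply i x)
  rw [defectHess]
  simp only [← sub_eq_add_neg, sin_sub_pi_div_two]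
  rw [map_add]
  congr 1
  · congr 2
    ext y : 1
    congr 1
    ring
  · ext v
    simp
    ring

/-- Duality: take the matrix `K` itself as the coefficients of the quadratic form. Then `S = ‖K‖²`
is the integral of the centred form against a cosine, so `S ≤ √(L S)` and hence `S ≤ L`. -/
lemma sum_sq_integral_quad_cos_le (x : EuclideanSpace ℝ (Fin n)) :
    ∑ i, ∑ j, (∫ y, (y i * y j - if i = j then 1 else 0) * cos (s * inner ℝ y x) ∂μ) ^ 2 ≤ L := by
  set K : Fin n → Fin n → ℝ :=
    fun i j => ∫ y, (y i * y j - if i = j then 1 else 0) * cos (s * inner ℝ y x) ∂μ with hK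
  set S := ∑ i, ∑ j, K i j ^ 2 with hS
  have hS0 : 0 ≤ S := by positivity
  have hi : ∀ i j : Fin n, Integrable (fun y : EuclideanSpace ℝ (Fin n) =>
      (y i * y j - if i = j then 1 else 0) * cos (s * inner ℝ y x)) μ := fun i j =>
    integrable_bdd_mul ((hμ.integrable_coord_mul_coord i j).sub (integrable_const _))
      (by fun_prop) fun y => abs_cos_le_one _
  have hq : ∀ y : EuclideanSpace ℝ (Fin n),
      ∑ i, ∑ j, K i j * (y i * y j - if i = j then 1 else 0) =
      ∑ i, ∑ j, K i j * y i * y j - ∑ i, K i i := by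
    intro y
    simp_rw [mul_sub, Finset.sum_sub_distrib]
    congr 1
    · simp_rw [mul_assoc]
    · simp
  have hqi : Integrable (fun y : EuclideanSpace ℝ (Fin n) =>
      ∑ i, ∑ j, K i j * y i * y j - ∑ i, K i i) μ := by
    simp_rw [← hq]
    refine integrable_finsetSum _ fun i _ => integrable_finsetSum _ fun j _ => ?_
    exact ((hμ.integrable_coord_mul_coord i j).sub (integrable_const _)).const_mul _
  have h1 : S = ∫ y, (∑ i, ∑ j, K i j * y i * y j - ∑ i, K i i) * cos (s * inner ℝ y x) ∂μ := by
    simp_rw [← hq, Finset.sum_mul, mul_assoc]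
    rw [integral_finsetSum _ fun i _ => integrable_finsetSum _ fun j _ => (hi i j).const_mul _]
    refine Finset.sum_congr rfl fun i _ => ?_
    rw [integral_finsetSum _ fun j _ => (hi i j).const_mul _]
    refine Finset.sum_congr rfl fun j _ => ?_
    rw [integral_const_mul, sq]
  have h2 : S ≤ √(L * S) := by
    refine le_trans ?_ (hμ.integral_abs_quad_le K)
    conv_lhs => rw [h1]
    refine integral_mono (integrable_bdd_mul hqi (by fun_prop) fun y => abs_cos_le_one _)
      hqi.abs fun y => ?_
    refine (le_abs_self _).trans ?_
    simp only [abs_mul _ (cos _)]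
    exact mul_le_of_le_one_right (abs_nonneg _) (abs_cos_le_one _)
  have h3 : S ^ 2 ≤ L * S := by
    have := hμ.one_le
    calc S ^ 2 ≤ √(L * S) ^ 2 := by gcongr
      _ = L * S := sq_sqrt (by positivity)
  rcases hS0.eq_or_lt with h0 | h0
  · rw [← h0]; linarith [hμ.one_le]
  · rw [sq] at h3
    exact le_of_mul_le_mul_right h3 h0

/-- Centring `y_i y_j` produces a diagonal `cosTransform`, which merges with the Gaussian diagonal
into `defect`. The remaining Gaussian term has rank one and bounded size. -/
lemma defectHess_apply (i j : Fin n) (x : EuclideanSpace ℝ (Fin n)) :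
    defectHess μ s i x j =
      -s ^ 2 * ((∫ y, (y i * y j - if i = j then 1 else 0) * cos (s * inner ℝ y x) ∂μ) +
        (if i = j then defect μ s x else 0) + s ^ 2 * gaussTransform s x * x i * x j) := by
  have h := hμ.inner_defectHess (s := s) i x (EuclideanSpace.single j 1)
  simp only [EuclideanSpace.inner_single_right, one_mul, RCLike.conj_to_real] at h
  have h1 : ∫ y, (y i * y j - if i = j then 1 else 0) * cos (s * inner ℝ y x) ∂μ =
      ∫ y, y i * y j * cos (s * inner ℝ y x) ∂μ - if i = j then cosTransform μ s x else 0 := by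
    simp_rw [sub_mul]
    rw [integral_sub (integrable_bdd_mul (hμ.integrable_coord_mul_coord i j) (by fun_prop)
      fun y => abs_cos_le_one _) (integrable_bdd_mul (integrable_const _) (by fun_prop)
      fun y => abs_cos_le_one _)]
    congr 1
    split_ifs <;> simp [cosTransform]
  rw [h, h1, defect]
  split_ifs with hij
  · subst hij; simp; ring
  · simp [hij]; ring

/-- The Hilbert-Schmidt norm of the Hessian. -/
lemma sum_norm_sq_defectHess_le (x : EuclideanSpace ℝ (Fin n)) :
    ∑ i, ‖defectHess μ s i x‖ ^ 2 ≤ 3 * s ^ 4 * (L + n * defect μ s x ^ 2 + 1) := by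
  have h1 := hμ.sum_sq_integral_quad_cos_le (s := s) x
  have h2 : ∑ i : Fin n, ∑ j : Fin n, (if i = j then defect μ s x else 0) ^ 2 =
      n * defect μ s x ^ 2 := by
    simp [ite_pow]
  have h3 : ∑ i, ∑ j, (s ^ 2 * gaussTransform s x * x i * x j) ^ 2 ≤ 1 := by
    have h4 : ∑ i, ∑ j, (s ^ 2 * gaussTransform s x * x i * x j) ^ 2 =
        (s ^ 2 * ‖x‖ ^ 2 * gaussTransform s x) ^ 2 := by
      rw [EuclideanSpace.real_norm_sq_eq]
      calc _ = (s ^ 2 * gaussTransform s x) ^ 2 * ((∑ i, x i ^ 2) * ∑ j, x j ^ 2) := by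
            rw [Finset.sum_mul_sum, Finset.mul_sum]
            refine Finset.sum_congr rfl fun i _ => ?_
            rw [Finset.mul_sum]
            refine Finset.sum_congr rfl fun j _ => ?_
            ring
        _ = _ := by ring
    rw [h4]
    exact pow_le_one₀ (mul_nonneg (by positivity) (gaussTransform_pos x).le)
      (sq_mul_norm_sq_mul_gaussTransform_le x)
  calc ∑ i, ‖defectHess μ s i x‖ ^ 2 = ∑ i, ∑ j, defectHess μ s i x j ^ 2 := by
        simp_rw [EuclideanSpace.real_norm_sq_eq]
    _ ≤ ∑ i, ∑ j, 3 * s ^ 4 *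
        ((∫ y, (y i * y j - if i = j then 1 else 0) * cos (s * inner ℝ y x) ∂μ) ^ 2 +
        (if i = j then defect μ s x else 0) ^ 2 +
          (s ^ 2 * gaussTransform s x * x i * x j) ^ 2) := by
        refine Finset.sum_le_sum fun i _ => Finset.sum_le_sum fun j _ => ?_
        rw [hμ.defectHess_apply, mul_pow]
        set a := ∫ y, (y i * y j - if i = j then 1 else 0) * cos (s * inner ℝ y x) ∂μ
        set b := if i = j then defect μ s x else 0
        set c := s ^ 2 * gaussTransform s x * x i * x j
        have : (a + b + c) ^ 2 ≤ 3 * (a ^ 2 + b ^ 2 + c ^ 2) := by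
          nlinarith [sq_nonneg (a - b), sq_nonneg (a - c), sq_nonneg (b - c)]
        calc _ = s ^ 4 * (a + b + c) ^ 2 := by ring
          _ ≤ s ^ 4 * (3 * (a ^ 2 + b ^ 2 + c ^ 2)) := by gcongr
          _ = _ := by ring
    _ = 3 * s ^ 4 *
        (∑ i, ∑ j, (∫ y, (y i * y j - if i = j then 1 else 0) * cos (s * inner ℝ y x) ∂μ) ^ 2 +
        ∑ i : Fin n, ∑ j : Fin n, (if i = j then defect μ s x else 0) ^ 2 +
          ∑ i, ∑ j, (s ^ 2 * gaussTransform s x * x i * x j) ^ 2) := by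
        simp_rw [Finset.sum_add_distrib.symm, Finset.mul_sum]
    _ ≤ _ := by
        rw [h2]
        gcongr

/-- Purely qualitative: the value of `B` never enters an estimate, it only supplies integrability.
-/
lemma exists_norm_defectGrad_le : ∃ B, ∀ x, ‖defectGrad μ s x‖ ≤ B := by
  refine ⟨∫ y, |s| * ‖y‖ ∂μ + (1 + s ^ 2), fun x => ?_⟩
  rw [defectGrad]
  refine (norm_add_le _ _).trans (add_le_add ?_ ?_)
  · refine norm_integral_le_of_norm_le (hμ.integrable_norm.const_mul _) (ae_of_all _ fun y => ?_)
    rw [norm_smul, norm_neg, norm_mul, norm_eq_abs, norm_eq_abs]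
    gcongr
    exact mul_le_of_le_one_right (abs_nonneg _) (abs_sin_le_one _)
  · have hg0 := gaussTransform_pos (s := s) x
    have hg1 := gaussTransform_le_one (s := s) x
    have hg2 := sq_mul_norm_sq_mul_gaussTransform_le (s := s) x
    rw [norm_smul, norm_eq_abs, abs_of_nonneg (by positivity)]
    have h1 : s ^ 2 * gaussTransform s x ≤ s ^ 2 := mul_le_of_le_one_right (sq_nonneg s) hg1
    have h2 : ‖x‖ ≤ 1 + ‖x‖ ^ 2 := by nlinarith [sq_nonneg (‖x‖ - 1)]
    calc s ^ 2 * gaussTransform s x * ‖x‖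
        ≤ s ^ 2 * gaussTransform s x * (1 + ‖x‖ ^ 2) := by gcongr
      _ ≤ _ := by linarith

end IsSecondOrderIsotropic

end CosTransform

end WeightedSums

namespace WeightedSums

/-! ### Concentration of the defect under the Gaussian measure. -/

section DefectConcentration

open Real

lemma integral_sub_mean_sq_eq {Ω : Type*} [MeasurableSpace Ω] {P : Measure Ω}
    [IsProbabilityMeasure P] {f : Ω → ℝ} (hf : MemLp f 2 P) :
    ∫ x, (f x - ∫ y, f y ∂P) ^ 2 ∂P = ∫ x, f x ^ 2 ∂P - (∫ x, f x ∂P) ^ 2 := by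
  have hf1 := hf.integrable (q := 2) (by norm_num)
  have hf2 := hf.integrable_sq
  set m := ∫ x, f x ∂P with hm
  have : ∀ x, (f x - m) ^ 2 = f x ^ 2 - 2 * m * f x + m ^ 2 := fun x => by ring
  simp_rw [this]
  rw [integral_add (f := fun x => f x ^ 2 - 2 * m * f x) (hf2.sub (hf1.const_mul _))
    (integrable_const _),
    integral_sub hf2 (hf1.const_mul _), integral_const_mul, ← hm]
  simp
  ring

lemma sq_integral_le {Ω : Type*} [MeasurableSpace Ω] {P : Measure Ω}
    [IsProbabilityMeasure P] {f : Ω → ℝ} (hf : MemLp f 2 P) :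
    (∫ x, f x ∂P) ^ 2 ≤ ∫ x, f x ^ 2 ∂P := by
  have h := integral_sub_mean_sq_eq hf
  have : 0 ≤ ∫ x, (f x - ∫ y, f y ∂P) ^ 2 ∂P := integral_nonneg fun _ => sq_nonneg _
  linarith

lemma memLp_two_of_bound {Ω : Type*} [MeasurableSpace Ω] {P : Measure Ω}
    [IsProbabilityMeasure P] {f : Ω → ℝ} (hf : AEStronglyMeasurable f P) {B : ℝ}
    (hB : ∀ x, |f x| ≤ B) : MemLp f 2 P :=
  MemLp.of_bound hf B (ae_of_all _ hB)

variable {n : ℕ} {μ : Measure (EuclideanSpace ℝ (Fin n))} {L : ℝ} {s : ℝ}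

lemma integral_stdGaussian_neg {E F : Type*} [NormedAddCommGroup E] [InnerProductSpace ℝ E]
    [FiniteDimensional ℝ E] [MeasurableSpace E] [BorelSpace E] [NormedAddCommGroup F]
    [NormedSpace ℝ F] (k : E → F) :
    ∫ x, k (-x) ∂(stdGaussian E) = ∫ x, k x ∂(stdGaussian E) := by
  conv_rhs => rw [← stdGaussian_map (LinearIsometryEquiv.neg ℝ (E := E))]
  exact ((LinearIsometryEquiv.neg ℝ (E := E)).toHomeomorph.measurableEmbedding.integral_map k).symm

lemma integral_cos_inner_stdGaussian (y : EuclideanSpace ℝ (Fin n)) :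
    ∫ x, cos (s * inner ℝ y x) ∂(stdGaussian (EuclideanSpace ℝ (Fin n))) =
      gaussTransform s y := by
  have h := charFun_stdGaussian (s • y)
  rw [charFun_apply] at h
  have h2 := congrArg Complex.re h
  have hre := integral_re (𝕜 := ℂ) (μ := stdGaussian (EuclideanSpace ℝ (Fin n)))
    (f := fun x => Complex.exp ((inner ℝ x (s • y) : ℝ) * Complex.I))
    (.of_bound (Continuous.aestronglyMeasurable (by fun_prop)) 1 (ae_of_all _ fun x => by
      rw [Complex.norm_exp_ofReal_mul_I]))
  simp only [RCLike.re_to_complex] at hre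
  rw [← hre] at h2
  simp only [Complex.exp_ofReal_mul_I_re, real_inner_smul_right, real_inner_comm y] at h2
  rw [gaussTransform, ← Complex.exp_ofReal_re]
  rw [h2]
  congr 2
  push_cast
  rw [norm_smul, norm_eq_abs]
  rw [show ((|s| * ‖y‖ : ℝ) : ℂ) ^ 2 = (((|s| * ‖y‖) ^ 2 : ℝ) : ℂ) by push_cast; ring, mul_pow,
    sq_abs]
  push_cast
  ring

lemma integral_abs_norm_sq_sub_stdGaussian_le :
    ∫ x, |‖x‖ ^ 2 - n| ∂(stdGaussian (EuclideanSpace ℝ (Fin n))) ≤ √(10 * n) := by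
  apply le_sqrt_of_sq_le
  refine (sq_integral_le ?_).trans ?_
  · rw [memLp_two_iff_integrable_sq (by fun_prop)]
    simp_rw [sq_abs]
    have h : ∀ x : EuclideanSpace ℝ (Fin n), (‖x‖ ^ 2 - (n : ℝ)) ^ 2 =
        ‖x‖ ^ 4 - 2 * n * ‖x‖ ^ 2 + n ^ 2 := fun x => by ring
    simp_rw [h]
    exact ((integrable_norm_pow_stdGaussian 4).sub
      ((integrable_norm_pow_stdGaussian 2).const_mul _)).add (integrable_const _)
  · simp_rw [sq_abs]
    exact integral_norm_sq_sub_sq_stdGaussian_le n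

/-- The factor `s² / 2` is common to both exponents and cancels, leaving a bound uniform in `s`. -/
lemma abs_gaussTransform_sub_le (hn : 0 < n) (hs : s ≠ 0) (y : EuclideanSpace ℝ (Fin n)) :
    |gaussTransform s y - exp (-(s ^ 2 * n / 2))| ≤ (n : ℝ)⁻¹ * |‖y‖ ^ 2 - n| := by
  have hs2 : 0 < s ^ 2 := by positivity
  have hn' : (0 : ℝ) < n := by exact_mod_cast hn
  refine (abs_exp_neg_sub_exp_neg_le (by positivity) (by positivity)).trans_eq ?_
  rw [show s ^ 2 * ‖y‖ ^ 2 / 2 - s ^ 2 * n / 2 = s ^ 2 / 2 * (‖y‖ ^ 2 - n) by ring, abs_mul,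
    abs_of_pos (by positivity : 0 < s ^ 2 / 2)]
  field_simp

lemma integrable_gaussTransform (ν : Measure (EuclideanSpace ℝ (Fin n))) [IsProbabilityMeasure ν] :
    Integrable (gaussTransform s) ν :=
  .of_bound continuous_gaussTransform.aestronglyMeasurable 1 (ae_of_all _ fun x => by
    rw [norm_eq_abs, abs_of_pos (gaussTransform_pos x)]; exact gaussTransform_le_one x)

lemma abs_integral_gaussTransform_sub_le (hn : 0 < n) (hs : s ≠ 0)
    (ν : Measure (EuclideanSpace ℝ (Fin n))) [IsProbabilityMeasure ν]
    (hν : Integrable (fun y => ‖y‖ ^ 2) ν) :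
    |∫ y, gaussTransform s y ∂ν - exp (-(s ^ 2 * n / 2))| ≤
      (n : ℝ)⁻¹ * ∫ y, |‖y‖ ^ 2 - n| ∂ν := by
  have h : ∫ y, gaussTransform s y ∂ν - exp (-(s ^ 2 * n / 2)) =
      ∫ y, (gaussTransform s y - exp (-(s ^ 2 * n / 2))) ∂ν := by
    rw [integral_sub (integrable_gaussTransform ν) (integrable_const _)]
    simp
  have hi : Integrable (fun y => |‖y‖ ^ 2 - (n : ℝ)|) ν := (hν.sub (integrable_const _)).abs
  rw [h, ← integral_const_mul]
  exact norm_integral_le_of_norm_le (f := fun y => gaussTransform s y - exp (-(s ^ 2 * n / 2)))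
    (hi.const_mul _)
    (ae_of_all _ fun y => abs_gaussTransform_sub_le hn hs y)

lemma continuous_cosTransform [IsProbabilityMeasure μ] : Continuous (cosTransform μ s) :=
  continuous_of_dominated (bound := fun _ => 1)
    (fun x => Continuous.aestronglyMeasurable (by fun_prop))
    (fun x => ae_of_all _ fun y => abs_cos_le_one _) (integrable_const _)
    (ae_of_all _ fun y => by fun_prop)

/-- Fubini, with the Gaussian characteristic function evaluated at `s y`. -/
lemma integral_cosTransform_stdGaussian [IsProbabilityMeasure μ] :
    ∫ x, cosTransform μ s x ∂(stdGaussian (EuclideanSpace ℝ (Fin n))) =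
      ∫ y, gaussTransform s y ∂μ := by
  unfold cosTransform
  rw [integral_integral_swap]
  · simp_rw [integral_cos_inner_stdGaussian]
  · refine .of_bound (Continuous.aestronglyMeasurable ?_) 1 (ae_of_all _ fun p => abs_cos_le_one _)
    simp only [Function.uncurry_def]
    fun_prop

namespace IsSecondOrderIsotropic

variable (hμ : IsSecondOrderIsotropic μ L)
include hμ

lemma integral_abs_norm_sq_sub_le : ∫ y, |‖y‖ ^ 2 - n| ∂μ ≤ √(L * n) := by
  have h := hμ.integral_abs_quad_le (fun i j => if i = j then 1 else 0)
  simp only [ite_mul, one_mul, zero_mul, Finset.sum_ite_eq, Finset.mem_univ, if_true, ite_pow,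
    one_pow, ne_eq, OfNat.ofNat_ne_zero, not_false_eq_true, zero_pow, Finset.sum_const,
    Finset.card_univ, Fintype.card_fin, nsmul_eq_mul, mul_one] at h
  refine le_of_eq_of_le (integral_congr_ae (ae_of_all _ fun y => ?_)) h
  simp only [EuclideanSpace.real_norm_sq_eq]
  simp only [sq]

lemma norm_defectHess_sq_le (i : Fin n) (x : EuclideanSpace ℝ (Fin n)) :
    ‖defectHess μ s i x‖ ^ 2 ≤ (3 * s ^ 2) ^ 2 := by
  have h := hμ.norm_sum_defectHess_le (s := s) (EuclideanSpace.single i 1) x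
  simp only [PiLp.single_apply, ite_smul, one_smul, zero_smul, Finset.sum_ite_eq',
    Finset.mem_univ, if_true, PiLp.norm_single, norm_one, mul_one] at h
  gcongr

variable [IsProbabilityMeasure μ]

/-- By Fubini the mean is the difference of the integrals of one radial function under `μ` and under
the Gaussian. Both are close to `exp (-s² n / 2)`, since `‖y‖² - n` has first absolute moment at
most `√(L n)`, respectively `√(10 n)`. Squaring the sum gives `(2 L + 20) n ≤ 22 L n`. -/
lemma integral_defect_sq_le (hn : 0 < n) (hs : s ≠ 0) :
    n * (∫ x, defect μ s x ∂(stdGaussian (EuclideanSpace ℝ (Fin n)))) ^ 2 ≤ 22 * L := by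
  have hn' : (0 : ℝ) < n := by exact_mod_cast hn
  have hL := hμ.one_le
  have h1 := abs_integral_gaussTransform_sub_le hn hs μ hμ.integrable_norm_sq
  have h2 := abs_integral_gaussTransform_sub_le hn hs (stdGaussian (EuclideanSpace ℝ (Fin n)))
    (integrable_norm_pow_stdGaussian 2)
  have h3 : ∫ x, defect μ s x ∂(stdGaussian (EuclideanSpace ℝ (Fin n))) =
      ∫ y, gaussTransform s y ∂μ -
        ∫ y, gaussTransform s y ∂(stdGaussian (EuclideanSpace ℝ (Fin n))) := by
    unfold defect
    rw [integral_sub _ (integrable_gaussTransform _), integral_cosTransform_stdGaussian]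
    exact .of_bound continuous_cosTransform.aestronglyMeasurable 1
      (ae_of_all _ fun x => abs_cosTransform_le x)
  set m := ∫ x, defect μ s x ∂(stdGaussian (EuclideanSpace ℝ (Fin n)))
  have h4 : |m| ≤ (n : ℝ)⁻¹ * (√(L * n) + √(10 * n)) := by
    rw [h3]
    have h5 := abs_sub_le (∫ y, gaussTransform s y ∂μ) (exp (-(s ^ 2 * n / 2)))
      (∫ y, gaussTransform s y ∂(stdGaussian (EuclideanSpace ℝ (Fin n))))
    rw [abs_sub_comm (exp _)] at h5
    have h6 := mul_le_mul_of_nonneg_left hμ.integral_abs_norm_sq_sub_le (inv_nonneg.2 hn'.le)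
    have h7 := mul_le_mul_of_nonneg_left (integral_abs_norm_sq_sub_stdGaussian_le (n := n))
      (inv_nonneg.2 hn'.le)
    rw [mul_add]
    linarith
  have h8 : m ^ 2 ≤ ((n : ℝ)⁻¹ * (√(L * n) + √(10 * n))) ^ 2 := by
    rw [← sq_abs]; gcongr
  have h9 : (√(L * n) + √(10 * n)) ^ 2 ≤ 22 * L * n := by
    have e1 := sq_sqrt (show 0 ≤ L * n by positivity)
    have e2 := sq_sqrt (show (0 : ℝ) ≤ 10 * n by positivity)
    nlinarith [sq_nonneg (√(L * n) - √(10 * n))]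
  calc n * m ^ 2 ≤ n * ((n : ℝ)⁻¹ * (√(L * n) + √(10 * n))) ^ 2 := by gcongr
    _ = (n : ℝ)⁻¹ * (√(L * n) + √(10 * n)) ^ 2 := by field_simp
    _ ≤ (n : ℝ)⁻¹ * (22 * L * n) := by gcongr
    _ = _ := by field_simp

lemma memLp_defect : MemLp (defect μ s) 2 (stdGaussian (EuclideanSpace ℝ (Fin n))) :=
  memLp_two_of_bound hμ.continuous_defect.aestronglyMeasurable abs_defect_le

lemma integrable_norm_sq_defectGrad :
    Integrable (fun x => ‖defectGrad μ s x‖ ^ 2) (stdGaussian (EuclideanSpace ℝ (Fin n))) := by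
  obtain ⟨B, hB⟩ := hμ.exists_norm_defectGrad_le (s := s)
  refine (memLp_two_of_bound (f := fun x => ‖defectGrad μ s x‖) (B := B)
    hμ.continuous_defectGrad.norm.aestronglyMeasurable fun x => ?_).integrable_sq
  rw [abs_norm]; exact hB x

lemma integral_sub_mean_defect_le :
    ∫ x, (defect μ s x - ∫ y, defect μ s y ∂(stdGaussian (EuclideanSpace ℝ (Fin n)))) ^ 2
      ∂(stdGaussian (EuclideanSpace ℝ (Fin n))) ≤
      5 / 2 * ∫ x, ‖defectGrad μ s x‖ ^ 2 ∂(stdGaussian (EuclideanSpace ℝ (Fin n))) := by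
  refine (integral_sub_mean_sq_le hμ.hasFDerivAt_defect hμ.continuous_defectGrad hμ.memLp_defect
    hμ.integrable_norm_sq_defectGrad).trans ?_
  gcongr ?_ * _
  nlinarith [pi_lt_d2, pi_pos]

/-- Poincaré for each component of the gradient, whose mean vanishes by oddness. -/
lemma integral_norm_sq_defectGrad_le_hess :
    ∫ x, ‖defectGrad μ s x‖ ^ 2 ∂(stdGaussian (EuclideanSpace ℝ (Fin n))) ≤
      5 / 2 * ∫ x, ∑ i, ‖defectHess μ s i x‖ ^ 2 ∂(stdGaussian (EuclideanSpace ℝ (Fin n))) := by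
  obtain ⟨B, hB⟩ := hμ.exists_norm_defectGrad_le (s := s)
  have hmem : ∀ i, MemLp (fun x => defectGrad μ s x i) 2
      (stdGaussian (EuclideanSpace ℝ (Fin n))) := fun i => by
    have := hμ.continuous_defectGrad (s := s)
    exact memLp_two_of_bound (Continuous.aestronglyMeasurable (by fun_prop))
      fun x => (PiLp.norm_apply_le _ i).trans (hB x)
  have hhess : ∀ i, Integrable (fun x => ‖defectHess μ s i x‖ ^ 2)
      (stdGaussian (EuclideanSpace ℝ (Fin n))) := fun i =>
    .of_bound ((hμ.continuous_defectHess i).norm.pow 2).aestronglyMeasurable ((3 * s ^ 2) ^ 2)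
      (ae_of_all _ fun x => by
        rw [norm_pow, norm_norm]; exact hμ.norm_defectHess_sq_le i x)
  have hmean : ∀ i, ∫ x, defectGrad μ s x i ∂(stdGaussian (EuclideanSpace ℝ (Fin n))) = 0 := by
    intro i
    have h := integral_stdGaussian_neg (fun x : EuclideanSpace ℝ (Fin n) => defectGrad μ s x i)
    simp only [defectGrad_neg, PiLp.neg_apply, integral_neg] at h
    linarith
  simp_rw [EuclideanSpace.real_norm_sq_eq (defectGrad μ s _)]
  rw [integral_finsetSum _ fun i _ => (hmem i).integrable_sq, integral_finsetSum _ fun i _ => hhess i,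
    Finset.mul_sum]
  refine Finset.sum_le_sum fun i _ => ?_
  have h := integral_sub_mean_sq_le (hμ.hasFDerivAt_defectGrad_apply (s := s) i)
    (hμ.continuous_defectHess i) (hmem i) (hhess i)
  simp only [hmean, sub_zero] at h
  refine h.trans ?_
  gcongr ?_ * _
  nlinarith [pi_lt_d2, pi_pos]

/-- A bootstrap: the Hessian bound contains `n E defect²`, which the first Poincaré inequality and
the bound on the mean return to the gradient integral `D`. The threshold `1 / 40` makes the
coefficient of `D` on the right `75 / 160 < 1 / 2`, so it is absorbed and `180` becomes at most
`360`. -/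
lemma integral_norm_sq_defectGrad_le (hn : 0 < n) (hs : s ≠ 0) (hsn : s ^ 4 * n ≤ 1 / 40) :
    ∫ x, ‖defectGrad μ s x‖ ^ 2 ∂(stdGaussian (EuclideanSpace ℝ (Fin n))) ≤ 360 * s ^ 4 * L := by
  have hL := hμ.one_le
  have h1 := hμ.integral_norm_sq_defectGrad_le_hess (s := s)
  have h2 := hμ.integral_sub_mean_defect_le (s := s)
  have h3 := hμ.integral_defect_sq_le hn hs
  rw [integral_sub_mean_sq_eq hμ.memLp_defect] at h2
  have hT2 := (hμ.memLp_defect (s := s)).integrable_sq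
  have h4 : ∫ x, ∑ i, ‖defectHess μ s i x‖ ^ 2 ∂(stdGaussian (EuclideanSpace ℝ (Fin n))) ≤
      3 * s ^ 4 * (L + n * ∫ x, defect μ s x ^ 2 ∂(stdGaussian (EuclideanSpace ℝ (Fin n))) + 1) := by
    have h5 : ∫ x, 3 * s ^ 4 * (L + n * defect μ s x ^ 2 + 1)
        ∂(stdGaussian (EuclideanSpace ℝ (Fin n))) =
        3 * s ^ 4 * (L + n * ∫ x, defect μ s x ^ 2 ∂(stdGaussian (EuclideanSpace ℝ (Fin n)))
          + 1) := by
      rw [integral_const_mul, integral_add (f := fun x => L + n * defect μ s x ^ 2)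
        ((integrable_const _).add (hT2.const_mul _)) (integrable_const _), integral_add (integrable_const _) (hT2.const_mul _),
        integral_const_mul]
      simp
    rw [← h5]
    refine integral_mono_of_nonneg (ae_of_all _ fun x => by positivity) ?_
      (ae_of_all _ fun x => hμ.sum_norm_sq_defectHess_le x)
    exact (((integrable_const _).add (hT2.const_mul _)).add (integrable_const _)).const_mul _
  set D := ∫ x, ‖defectGrad μ s x‖ ^ 2 ∂(stdGaussian (EuclideanSpace ℝ (Fin n)))
  set m := ∫ x, defect μ s x ∂(stdGaussian (EuclideanSpace ℝ (Fin n)))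
  set S := ∫ x, defect μ s x ^ 2 ∂(stdGaussian (EuclideanSpace ℝ (Fin n)))
  have hD : 0 ≤ D := integral_nonneg fun _ => sq_nonneg _
  have h6 : n * S ≤ 22 * L + 5 / 2 * (n * D) := by
    have hn' : (0 : ℝ) ≤ n := by positivity
    nlinarith
  have h7 : D ≤ 15 / 2 * s ^ 4 * (24 * L + 5 / 2 * (n * D)) := by
    calc D ≤ 5 / 2 * (3 * s ^ 4 * (L + n * S + 1)) := by linarith
      _ ≤ 5 / 2 * (3 * s ^ 4 * (L + (22 * L + 5 / 2 * (n * D)) + L)) := by gcongr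
      _ = _ := by ring
  have h8 : s ^ 4 * n * D ≤ 1 / 40 * D := by gcongr
  nlinarith

lemma integral_sub_mean_defect_sq_le (hn : 0 < n) (hs : s ≠ 0) (hsn : s ^ 4 * n ≤ 1 / 40) :
    ∫ x, (defect μ s x - ∫ y, defect μ s y ∂(stdGaussian (EuclideanSpace ℝ (Fin n)))) ^ 2
      ∂(stdGaussian (EuclideanSpace ℝ (Fin n))) ≤ 900 * s ^ 4 * L := by
  have h1 := hμ.integral_sub_mean_defect_le (s := s)
  have h2 := hμ.integral_norm_sq_defectGrad_le hn hs hsn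
  linarith

/-- Exponential integrability of the squared gradient. -/
lemma lintegral_exp_norm_sq_defectGrad_le (hn : 0 < n) (hs : s ≠ 0) (hsn : s ^ 4 * n ≤ 1 / 40)
    {l : ℝ} (hl : 1600 * (l ^ 2 * s ^ 4 * L) ≤ 1) :
    ∫⁻ x, ENNReal.ofReal (exp (π ^ 2 * l ^ 2 / 8 * ‖defectGrad μ s x‖ ^ 2))
      ∂(stdGaussian (EuclideanSpace ℝ (Fin n))) ≤ 6 := by
  have hL := hμ.one_le
  have hs4 : 0 < s ^ 4 := by positivity
  have hpi : π ^ 2 ≤ 10 := by nlinarith [pi_lt_d2, pi_pos]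
  obtain ⟨B, hB⟩ := hμ.exists_norm_defectGrad_le (s := s)
  -- Adding `s⁴` makes the gradient norm differentiable at its zeros, at a cost of lower order than
  -- `360 s⁴ L` allows. The gradient of `N` inherits the operator norm bound `3 s²` of the Hessian.
  set N : EuclideanSpace ℝ (Fin n) → ℝ := fun x => √(s ^ 4 + ∑ i, defectGrad μ s x i ^ 2) with hN
  have hNsq : ∀ x, N x ^ 2 = s ^ 4 + ‖defectGrad μ s x‖ ^ 2 := fun x => by
    rw [hN, EuclideanSpace.real_norm_sq_eq]
    exact sq_sqrt (by positivity)
  have hNpos : ∀ x, 0 < N x := fun x => sqrt_pos.2 (by positivity)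
  set gN : EuclideanSpace ℝ (Fin n) → EuclideanSpace ℝ (Fin n) :=
    fun x => (N x)⁻¹ • ∑ i, defectGrad μ s x i • defectHess μ s i x with hgN
  have hNd : ∀ x, HasFDerivAt N (innerSL ℝ (gN x)) x := by
    intro x
    have h1 : HasFDerivAt (fun x => s ^ 4 + ∑ i, defectGrad μ s x i ^ 2)
        (∑ i, (2 * defectGrad μ s x i) • innerSL ℝ (defectHess μ s i x)) x := by
      refine HasFDerivAt.const_add _ (HasFDerivAt.fun_sum fun i _ => ?_)
      refine ((hμ.hasFDerivAt_defectGrad_apply i x).pow 2).congr_fderiv ?_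
      simp
    refine (h1.sqrt (by positivity)).congr_fderiv ?_
    have h2 : √(s ^ 4 + ∑ i, defectGrad μ s x i ^ 2) = N x := rfl
    rw [h2]
    simp only [hgN, map_smul, map_sum, Finset.smul_sum, smul_smul]
    refine Finset.sum_congr rfl fun i _ => ?_
    congr 1
    have := (hNpos x).ne'
    field_simp
  have hgNc : Continuous gN := by
    have h1 := hμ.continuous_defectGrad (s := s)
    have h2 := fun i => hμ.continuous_defectHess (s := s) i
    have h3 : Continuous N := by rw [hN]; fun_prop
    exact (h3.inv₀ fun x => (hNpos x).ne').smul (continuous_finsetSum _ fun i _ => by fun_prop)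
  have hgNb : ∀ x, ‖gN x‖ ≤ 3 * s ^ 2 := by
    intro x
    have h1 := hμ.norm_sum_defectHess_le (s := s) (defectGrad μ s x) x
    have h2 : ‖defectGrad μ s x‖ ≤ N x := by
      refine (pow_le_pow_iff_left₀ (norm_nonneg _) (hNpos x).le two_ne_zero).1 ?_
      rw [hNsq]; linarith
    rw [hgN, norm_smul, norm_inv, norm_eq_abs, abs_of_pos (hNpos x), inv_mul_le_iff₀ (hNpos x)]
    calc _ ≤ 3 * s ^ 2 * ‖defectGrad μ s x‖ := h1
      _ ≤ 3 * s ^ 2 * N x := by gcongr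
      _ = _ := mul_comm _ _
  have hNB : ∀ x, |N x| ≤ √(s ^ 4 + B ^ 2) := by
    intro x
    rw [abs_of_pos (hNpos x)]
    apply le_sqrt_of_sq_le
    rw [hNsq]
    gcongr
    exact hB x
  have hNc : Continuous N := continuous_iff_continuousAt.2 fun x => (hNd x).continuousAt
  have hmem : MemLp N 2 (stdGaussian (EuclideanSpace ℝ (Fin n))) :=
    memLp_two_of_bound hNc.aestronglyMeasurable hNB
  set M := ∫ x, N x ∂(stdGaussian (EuclideanSpace ℝ (Fin n))) with hM
  have hM2 : M ^ 2 ≤ 361 * s ^ 4 * L := by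
    refine (sq_integral_le hmem).trans ?_
    simp_rw [hNsq]
    rw [integral_add (integrable_const _) hμ.integrable_norm_sq_defectGrad]
    have := hμ.integral_norm_sq_defectGrad_le hn hs hsn
    simp only [integral_const, probReal_univ, smul_eq_mul, one_mul]
    nlinarith
  have hl0 : l ^ 2 * s ^ 4 ≤ l ^ 2 * s ^ 4 * L := le_mul_of_one_le_right (by positivity) hL
  -- Twice the target exponent, since `‖defectGrad‖² ≤ N² ≤ 2 M² + 2 (N - M)²`. The `M²` part
  -- contributes at most `exp 1 ≤ 3`.
  have h3 := lintegral_exp_sub_mean_sq_le hNd hgNc hNB hgNb (a := π ^ 2 * l ^ 2 / 4)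
    (by positivity) (by
      calc π ^ 2 * l ^ 2 / 4 * (π ^ 2 / 4 * (3 * s ^ 2) ^ 2)
          = 9 / 16 * π ^ 2 * π ^ 2 * (l ^ 2 * s ^ 4) := by ring
        _ ≤ 9 / 16 * 10 * 10 * (l ^ 2 * s ^ 4) := by gcongr
        _ ≤ _ := by linarith)
  have hpt : ∀ x, exp (π ^ 2 * l ^ 2 / 8 * ‖defectGrad μ s x‖ ^ 2) ≤
      3 * exp (π ^ 2 * l ^ 2 / 4 * (N x - M) ^ 2) := by
    intro x
    have e1 : π ^ 2 * l ^ 2 / 8 * ‖defectGrad μ s x‖ ^ 2 ≤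
        1 + π ^ 2 * l ^ 2 / 4 * (N x - M) ^ 2 := by
      have e2 : ‖defectGrad μ s x‖ ^ 2 ≤ 2 * M ^ 2 + 2 * (N x - M) ^ 2 := by
        nlinarith [hNsq x, sq_nonneg (N x - 2 * M)]
      have e3 : π ^ 2 * l ^ 2 / 4 * M ^ 2 ≤ 1 := by
        calc π ^ 2 * l ^ 2 / 4 * M ^ 2 ≤ 10 * l ^ 2 / 4 * (361 * s ^ 4 * L) := by gcongr
          _ = 902.5 * (l ^ 2 * s ^ 4 * L) := by ring
          _ ≤ 1 := by
            have : 0 ≤ l ^ 2 * s ^ 4 * L := by positivity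
            linarith
      have e4 : π ^ 2 * l ^ 2 / 8 * ‖defectGrad μ s x‖ ^ 2 ≤
          π ^ 2 * l ^ 2 / 8 * (2 * M ^ 2 + 2 * (N x - M) ^ 2) := by gcongr
      linarith
    calc _ ≤ exp (1 + π ^ 2 * l ^ 2 / 4 * (N x - M) ^ 2) := exp_le_exp.2 e1
      _ = exp 1 * exp (π ^ 2 * l ^ 2 / 4 * (N x - M) ^ 2) := exp_add _ _
      _ ≤ _ := by
        gcongr
        linarith [exp_one_lt_d9]
  calc _ ≤ ∫⁻ x, ENNReal.ofReal 3 * ENNReal.ofReal (exp (π ^ 2 * l ^ 2 / 4 * (N x - M) ^ 2))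
        ∂(stdGaussian (EuclideanSpace ℝ (Fin n))) := by
        refine lintegral_mono fun x => ?_
        rw [← ENNReal.ofReal_mul (by norm_num)]
        exact ENNReal.ofReal_le_ofReal (hpt x)
    _ = ENNReal.ofReal 3 * ∫⁻ x, ENNReal.ofReal (exp (π ^ 2 * l ^ 2 / 4 * (N x - M) ^ 2))
        ∂(stdGaussian (EuclideanSpace ℝ (Fin n))) :=
        lintegral_const_mul _ (by fun_prop)
    _ ≤ ENNReal.ofReal 3 * 2 := by gcongr
    _ = 6 := by
      rw [show (2 : ℝ≥0∞) = ENNReal.ofReal 2 by simp, ← ENNReal.ofReal_mul (by norm_num)]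
      norm_num

/-- The one-sided bounds at `l` and `-l` add up, `6 + 6`. With `l = 1 / (40 s² L)` the quantity
`1600 l² s⁴ L` equals `1 / L`, at most `1`. -/
theorem integral_exp_abs_sub_mean_defect_le (hn : 0 < n) (hs : s ≠ 0)
    (hsn : s ^ 4 * n ≤ 1 / 40) :
    ∫ x, exp ((40 * s ^ 2 * L)⁻¹ *
        |defect μ s x - ∫ y, defect μ s y ∂(stdGaussian (EuclideanSpace ℝ (Fin n)))|)
      ∂(stdGaussian (EuclideanSpace ℝ (Fin n))) ≤ 12 := by
  have hL := hμ.one_le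
  set l := (40 * s ^ 2 * L)⁻¹ with hl
  set m := ∫ y, defect μ s y ∂(stdGaussian (EuclideanSpace ℝ (Fin n))) with hm
  have hlL : ∀ l' : ℝ, l' ^ 2 = l ^ 2 → 1600 * (l' ^ 2 * s ^ 4 * L) ≤ 1 := by
    intro l' h
    rw [h, hl]
    have : 1600 * ((40 * s ^ 2 * L)⁻¹ ^ 2 * s ^ 4 * L) = L⁻¹ := by field_simp; ring
    rw [this]
    exact inv_le_one_of_one_le₀ hL
  have key : ∀ l' : ℝ, l' ^ 2 = l ^ 2 →
      ∫⁻ x, ENNReal.ofReal (exp (l' * (defect μ s x - m)))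
        ∂(stdGaussian (EuclideanSpace ℝ (Fin n))) ≤ 6 := fun l' h =>
    (lintegral_exp_sub_mean_le hμ.hasFDerivAt_defect hμ.continuous_defectGrad
      abs_defect_le l').trans (hμ.lintegral_exp_norm_sq_defectGrad_le hn hs hsn (hlL l' h))
  have hc := hμ.continuous_defect (s := s)
  rw [integral_eq_lintegral_of_nonneg_ae (ae_of_all _ fun x => (exp_pos _).le)
    (Continuous.aestronglyMeasurable (by fun_prop))]
  refine ENNReal.toReal_le_of_le_ofReal (by norm_num) ?_
  calc _ ≤ ∫⁻ x, (ENNReal.ofReal (exp (l * (defect μ s x - m))) +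
        ENNReal.ofReal (exp (-l * (defect μ s x - m))))
          ∂(stdGaussian (EuclideanSpace ℝ (Fin n))) := by
        refine lintegral_mono fun x => ?_
        rw [← ENNReal.ofReal_add (exp_pos _).le (exp_pos _).le]
        apply ENNReal.ofReal_le_ofReal
        rcases abs_cases (defect μ s x - m) with ⟨h, _⟩ | ⟨h, _⟩ <;> rw [h]
        · linarith [exp_pos (-l * (defect μ s x - m))]
        · rw [mul_neg, ← neg_mul]
          linarith [exp_pos (l * (defect μ s x - m))]
    _ ≤ 6 + 6 := by
        rw [lintegral_add_left (by fun_prop)]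
        exact add_le_add (key l rfl) (key (-l) (by ring))
    _ = ENNReal.ofReal 12 := by norm_num

end IsSecondOrderIsotropic

end DefectConcentration

end WeightedSums

namespace WeightedSums

/-! ### Polar decomposition of the Gaussian measure. -/

section Polar

open Real

lemma withDensity_comp_map {α β : Type*} [MeasurableSpace α] [MeasurableSpace β]
    {m : Measure α} {φ : α → β} (hφ : Measurable φ) {ρ : β → ℝ≥0∞} (hρ : Measurable ρ) :
    (m.withDensity (ρ ∘ φ)).map φ = (m.map φ).withDensity ρ := by
  ext A hA
  rw [Measure.map_apply hφ hA, withDensity_apply _ (hφ hA), withDensity_apply _ hA,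
    setLIntegral_map hA hρ hφ]
  rfl

/-- Equality of characteristic functions. Only the radial form of the density is used afterwards, so
the normalisation `Z` merely has to cancel. -/
lemma exists_stdGaussian_eq_withDensity (E : Type*) [NormedAddCommGroup E]
    [InnerProductSpace ℝ E] [FiniteDimensional ℝ E] [MeasurableSpace E] [BorelSpace E] :
    ∃ ρ : ℝ → ℝ≥0∞, Measurable ρ ∧
      stdGaussian E = (volume : Measure E).withDensity fun x => ρ ‖x‖ := by
  set Z : ℝ := ∫ x : E, exp (-(1 / 2) * ‖x‖ ^ 2) with hZ
  have hb : 0 < ((1 / 2 : ℝ) : ℂ).re := by simp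
  have hb' : ((1 / 2 : ℝ) : ℂ) ≠ 0 := by simp
  have hZpos : 0 < Z := by
    rw [hZ, GaussianFourier.integral_rexp_neg_mul_sq_norm (by norm_num : (0 : ℝ) < 1 / 2)]
    positivity
  -- A non-integrable function has Bochner integral `0`, so `Z > 0` already forces integrability.
  have hint : Integrable fun x : E => exp (-(1 / 2) * ‖x‖ ^ 2) := by
    by_contra h
    rw [hZ, integral_undef h] at hZpos
    exact lt_irrefl _ hZpos
  have hZc : (Z : ℂ) = (π / ((1 / 2 : ℝ) : ℂ)) ^ (Module.finrank ℝ E / 2 : ℂ) := by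
    rw [← GaussianFourier.integral_cexp_neg_mul_sq_norm hb, hZ, ← integral_complex_ofReal]
    simp
  set d : ℝ → ℝ := fun r => Z⁻¹ * exp (-(1 / 2) * r ^ 2) with hd
  have hdc : Continuous d := by fun_prop
  refine ⟨fun r => ENNReal.ofReal (d r), by fun_prop, ?_⟩
  have : IsFiniteMeasure ((volume : Measure E).withDensity fun x => ENNReal.ofReal (d ‖x‖)) :=
    isFiniteMeasure_withDensity_ofReal (hint.const_mul _).2
  refine Measure.ext_of_charFun ?_
  ext t
  rw [charFun_stdGaussian, charFun_apply, integral_withDensity_eq_integral_toReal_smul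
    (by fun_prop) (ae_of_all _ fun _ => ENNReal.ofReal_lt_top)]
  have h1 : ∀ x : E, (ENNReal.ofReal (d ‖x‖)).toReal • Complex.exp ((inner ℝ x t : ℝ) * Complex.I)
      = (Z : ℂ)⁻¹ * Complex.exp (-((1 / 2 : ℝ) : ℂ) * ‖x‖ ^ 2 + Complex.I * (inner ℝ t x : ℝ)) := by
    intro x
    rw [ENNReal.toReal_ofReal (by positivity), hd, Complex.exp_add, Complex.real_smul,
      real_inner_comm]
    push_cast
    rw [mul_comm Complex.I]
    ring
  simp_rw [h1]
  rw [integral_const_mul, GaussianFourier.integral_cexp_neg_mul_sq_norm_add hb, ← hZc, ← mul_assoc,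
    inv_mul_cancel₀ (by exact_mod_cast hZpos.ne'), one_mul, Complex.I_sq]
  congr 1
  push_cast
  ring

lemma map_smul_toSphere_prod (E : Type*) [NormedAddCommGroup E]
    [NormedSpace ℝ E] [FiniteDimensional ℝ E] [Nontrivial E] [MeasurableSpace E] [BorelSpace E]
    (m : Measure E) [m.IsAddHaarMeasure] :
    (m.toSphere.prod (Measure.volumeIoiPow (Module.finrank ℝ E - 1))).map
      (fun p => (p.2 : ℝ) • (p.1 : E)) = m := by
  have h := (m.measurePreserving_homeomorphUnitSphereProd.symm
    (homeomorphUnitSphereProd E).toMeasurableEquiv).map_eq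
  have h2 : (fun p : Metric.sphere (0 : E) 1 × Set.Ioi (0 : ℝ) => (p.2 : ℝ) • (p.1 : E)) =
      Subtype.val ∘ (homeomorphUnitSphereProd E).toMeasurableEquiv.symm := by
    ext p
    exact (homeomorphUnitSphereProd_symm_apply_coe E p).symm
  rw [h2, ← Measure.map_map measurable_subtype_coe (MeasurableEquiv.measurable _), h,
    map_comap_subtype_coe (measurableSet_singleton _).compl, restrict_compl_singleton]

/-- Polar decomposition of the standard Gaussian measure: the radius and the direction are
independent, and the direction is uniform on the sphere. -/
theorem exists_polar_stdGaussian {n : ℕ} (hn : 0 < n) :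
    IsProbabilityMeasure (sphereUniform n) ∧
    ∃ ν : Measure (Set.Ioi (0 : ℝ)), IsProbabilityMeasure ν ∧
      MeasurePreserving (fun p : Metric.sphere (0 : EuclideanSpace ℝ (Fin n)) 1 × Set.Ioi (0 : ℝ) =>
        (p.2 : ℝ) • (p.1 : EuclideanSpace ℝ (Fin n)))
        ((sphereUniform n).prod ν) (stdGaussian (EuclideanSpace ℝ (Fin n))) := by
  have : Nonempty (Fin n) := ⟨⟨0, hn⟩⟩
  set σ := (volume : Measure (EuclideanSpace ℝ (Fin n))).toSphere with hσ
  have ha0 : σ Set.univ ≠ 0 := by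
    rw [Measure.measure_univ_ne_zero]; exact Measure.toSphere_ne_zero _
  have hat : σ Set.univ ≠ ∞ := measure_ne_top _ _
  have hprob : IsProbabilityMeasure (sphereUniform n) := ⟨by
    rw [sphereUniform, Measure.smul_apply, smul_eq_mul, ENNReal.inv_mul_cancel ha0 hat]⟩
  refine ⟨hprob, ?_⟩
  obtain ⟨ρ, hρ, hγ⟩ := exists_stdGaussian_eq_withDensity (EuclideanSpace ℝ (Fin n))
  set ν₀ := (Measure.volumeIoiPow (Module.finrank ℝ (EuclideanSpace ℝ (Fin n)) - 1)).withDensity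
    fun r => ρ r with hν₀
  have hmeas : Measurable fun p : Metric.sphere (0 : EuclideanSpace ℝ (Fin n)) 1 × Set.Ioi (0 : ℝ) =>
      (p.2 : ℝ) • (p.1 : EuclideanSpace ℝ (Fin n)) := by fun_prop
  have hmap : (σ.prod ν₀).map (fun p => (p.2 : ℝ) • (p.1 : EuclideanSpace ℝ (Fin n))) =
      stdGaussian (EuclideanSpace ℝ (Fin n)) := by
    rw [hν₀, prod_withDensity_right (by fun_prop), hγ]
    conv_rhs => rw [← map_smul_toSphere_prod (EuclideanSpace ℝ (Fin n)) volume]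
    rw [← withDensity_comp_map hmeas (by fun_prop)]
    congr 2
    ext p
    have hp : ‖(p.1 : EuclideanSpace ℝ (Fin n))‖ = 1 := by simp
    simp only [Function.comp_apply, norm_smul, hp, mul_one, norm_eq_abs]
    rw [abs_of_pos p.2.2]
  have hprod : (sphereUniform n).prod (σ Set.univ • ν₀) = σ.prod ν₀ := by
    rw [sphereUniform, ← hσ, Measure.prod_smul_left, Measure.prod_smul_right, smul_smul,
      ENNReal.inv_mul_cancel ha0 hat, one_smul]
  have hmp : MeasurePreserving
      (fun p : Metric.sphere (0 : EuclideanSpace ℝ (Fin n)) 1 × Set.Ioi (0 : ℝ) =>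
        (p.2 : ℝ) • (p.1 : EuclideanSpace ℝ (Fin n)))
      ((sphereUniform n).prod (σ Set.univ • ν₀)) (stdGaussian (EuclideanSpace ℝ (Fin n))) :=
    ⟨hmeas, by rw [hprod, hmap]⟩
  refine ⟨σ Set.univ • ν₀, ⟨?_⟩, hmp⟩
  have h1 := hmp.measure_preimage MeasurableSet.univ.nullMeasurableSet
  rw [Set.preimage_univ, measure_univ (μ := stdGaussian _), ← Set.univ_prod_univ, Measure.prod_prod, measure_univ,
    one_mul] at h1
  exact h1

end Polar

end WeightedSums

namespace WeightedSums

/-! ### Replacing the Gaussian radius by `√n`. -/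

section Sphere

open Real

variable {n : ℕ} {μ : Measure (EuclideanSpace ℝ (Fin n))} {L : ℝ} {s : ℝ}
  {ν : Measure (Set.Ioi (0 : ℝ))}

lemma abs_integral_le_of_abs_le {Ω : Type*} [MeasurableSpace Ω] {P : Measure Ω} {f k : Ω → ℝ}
    (hk : Integrable k P) (h : ∀ y, |f y| ≤ k y) : |∫ y, f y ∂P| ≤ ∫ y, k y ∂P :=
  norm_integral_le_of_norm_le (f := f) hk (ae_of_all _ h)

lemma map_coe_eq_map_norm [IsProbabilityMeasure (sphereUniform n)] [IsProbabilityMeasure ν]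
    (hν : MeasurePreserving
      (fun p : Metric.sphere (0 : EuclideanSpace ℝ (Fin n)) 1 × Set.Ioi (0 : ℝ) =>
        (p.2 : ℝ) • (p.1 : EuclideanSpace ℝ (Fin n)))
      ((sphereUniform n).prod ν) (stdGaussian (EuclideanSpace ℝ (Fin n)))) :
    (stdGaussian (EuclideanSpace ℝ (Fin n))).map norm = ν.map Subtype.val := by
  rw [← hν.map_eq, Measure.map_map measurable_norm hν.measurable]
  have h : norm ∘ (fun p : Metric.sphere (0 : EuclideanSpace ℝ (Fin n)) 1 × Set.Ioi (0 : ℝ) =>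
      (p.2 : ℝ) • (p.1 : EuclideanSpace ℝ (Fin n))) = Subtype.val ∘ Prod.snd := by
    ext p
    have hp : ‖(p.1 : EuclideanSpace ℝ (Fin n))‖ = 1 := by simp
    simp only [Function.comp_apply, norm_smul, hp, mul_one, norm_eq_abs]
    rw [abs_of_pos p.2.2]
  rw [h, ← Measure.map_map measurable_subtype_coe measurable_snd, Measure.map_snd_prod,
    measure_univ, one_smul]

lemma integral_radius (h : (stdGaussian (EuclideanSpace ℝ (Fin n))).map norm =
    ν.map Subtype.val) {k : ℝ → ℝ} (hk : Continuous k) :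
    ∫ r : Set.Ioi (0 : ℝ), k r ∂ν = ∫ x, k ‖x‖ ∂(stdGaussian (EuclideanSpace ℝ (Fin n))) := by
  rw [← integral_map (φ := norm) (by fun_prop) hk.aestronglyMeasurable, h,
    integral_map (by fun_prop) hk.aestronglyMeasurable]

lemma integrable_radius (h : (stdGaussian (EuclideanSpace ℝ (Fin n))).map norm =
    ν.map Subtype.val) {k : ℝ → ℝ} (hk : Continuous k)
    (hi : Integrable (fun x => k ‖x‖) (stdGaussian (EuclideanSpace ℝ (Fin n)))) :
    Integrable (fun r : Set.Ioi (0 : ℝ) => k r) ν := by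
  have h1 : Integrable k (ν.map Subtype.val) := by
    rw [← h]
    exact (integrable_map_measure hk.aestronglyMeasurable (by fun_prop)).2 hi
  exact (integrable_map_measure hk.aestronglyMeasurable (by fun_prop)).1 h1

/-- The mean square deviation of the radius from `√n`. -/
lemma integral_radius_sub_sq_le (hn : 0 < n)
    (h : (stdGaussian (EuclideanSpace ℝ (Fin n))).map norm = ν.map Subtype.val) :
    ∫ r : Set.Ioi (0 : ℝ), ((r : ℝ) - √n) ^ 2 ∂ν ≤ 10 := by
  have hn' : (0 : ℝ) < n := by exact_mod_cast hn
  rw [integral_radius h (k := fun r => (r - √n) ^ 2) (by fun_prop)]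
  have hpt : ∀ x : EuclideanSpace ℝ (Fin n),
      (‖x‖ - √n) ^ 2 ≤ (n : ℝ)⁻¹ * (‖x‖ ^ 2 - n) ^ 2 := by
    intro x
    have e1 : (‖x‖ ^ 2 - n) ^ 2 = (‖x‖ - √n) ^ 2 * (‖x‖ + √n) ^ 2 := by
      rw [← mul_pow]
      congr 1
      nlinarith [sq_sqrt hn'.le]
    have e2 : (n : ℝ) ≤ (‖x‖ + √n) ^ 2 := by
      have := norm_nonneg x
      nlinarith [sq_sqrt hn'.le, sqrt_nonneg (n : ℝ)]
    rw [e1, inv_mul_eq_div, le_div_iff₀ hn']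
    gcongr
  have hi : Integrable (fun x : EuclideanSpace ℝ (Fin n) => (‖x‖ ^ 2 - (n : ℝ)) ^ 2)
      (stdGaussian (EuclideanSpace ℝ (Fin n))) := by
    have e : ∀ x : EuclideanSpace ℝ (Fin n), (‖x‖ ^ 2 - (n : ℝ)) ^ 2 =
        ‖x‖ ^ 4 - 2 * n * ‖x‖ ^ 2 + n ^ 2 := fun x => by ring
    simp_rw [e]
    exact ((integrable_norm_pow_stdGaussian 4).sub
      ((integrable_norm_pow_stdGaussian 2).const_mul _)).add (integrable_const _)
  calc _ ≤ ∫ x, (n : ℝ)⁻¹ * (‖x‖ ^ 2 - n) ^ 2 ∂(stdGaussian (EuclideanSpace ℝ (Fin n))) :=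
        integral_mono_of_nonneg (ae_of_all _ fun x => sq_nonneg _) (hi.const_mul _)
          (ae_of_all _ hpt)
    _ ≤ (n : ℝ)⁻¹ * (10 * n) := by
        rw [integral_const_mul]
        gcongr
        exact integral_norm_sq_sub_sq_stdGaussian_le n
    _ = 10 := by field_simp

/-- Averaging over the radius changes the characteristic function on the sphere only by `O(s²)`. -/
lemma IsSecondOrderIsotropic.abs_integral_radius_cosTransform_sub_le [IsProbabilityMeasure μ]
    [IsProbabilityMeasure ν] (hμ : IsSecondOrderIsotropic μ L) (hn : 0 < n)
    (h : (stdGaussian (EuclideanSpace ℝ (Fin n))).map norm = ν.map Subtype.val)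
    (x : EuclideanSpace ℝ (Fin n)) (hx : ‖x‖ = 1) :
    |∫ r : Set.Ioi (0 : ℝ), cosTransform μ s ((r : ℝ) • x) ∂ν - cosTransform μ s (√n • x)| ≤
      25 * s ^ 2 := by
  have hn' : (0 : ℝ) < n := by exact_mod_cast hn
  have hin : Integrable (fun y => inner ℝ y x) μ :=
    (hμ.integrable_norm.mul_const ‖x‖).mono' (by fun_prop)
      (ae_of_all _ fun y => norm_inner_le_norm (𝕜 := ℝ) y x)
  have hin2 : Integrable (fun y => inner ℝ y x ^ 2) μ := by
    simpa [sq] using hμ.integrable_inner_mul_inner x x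
  -- `-A` is the radial derivative at `√n`. The bound `|sin z| ≤ |z|` gives it size `s² √n`.
  set A := ∫ y, s * inner ℝ y x * sin (√n * (s * inner ℝ y x)) ∂μ with hA
  have hAi : Integrable (fun y => s * inner ℝ y x * sin (√n * (s * inner ℝ y x))) μ :=
    integrable_bdd_mul (hin.const_mul s) (by fun_prop) fun y => abs_sin_le_one _
  have hA1 : |A| ≤ s ^ 2 * √n := by
    calc |A| ≤ ∫ y, s ^ 2 * √n * inner ℝ y x ^ 2 ∂μ := by
          refine abs_integral_le_of_abs_le (hin2.const_mul _) fun y => ?_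
          rw [abs_mul]
          calc |s * inner ℝ y x| * |sin (√n * (s * inner ℝ y x))|
              ≤ |s * inner ℝ y x| * |√n * (s * inner ℝ y x)| := by
                gcongr |s * inner ℝ y x| * ?_
                exact abs_sin_le_abs
            _ = √n * |s * inner ℝ y x| ^ 2 := by
                rw [abs_mul (√n), abs_of_nonneg (sqrt_nonneg _)]; ring
            _ = _ := by rw [sq_abs]; ring
      _ = _ := by rw [integral_const_mul, hμ.integral_inner_sq, hx]; ring
  have hci : ∀ r : ℝ, Integrable (fun y => cos (r * (s * inner ℝ y x))) μ := fun r =>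
    .of_bound (Continuous.aestronglyMeasurable (by fun_prop)) 1
      (ae_of_all _ fun y => abs_cos_le_one _)
  have hk : ∀ r : ℝ, cosTransform μ s (r • x) = ∫ y, cos (r * (s * inner ℝ y x)) ∂μ := fun r => by
    unfold cosTransform
    simp_rw [inner_smul_right]
    refine integral_congr_ae (ae_of_all _ fun y => ?_)
    ring_nf
  have hr : ∀ r : ℝ, |cosTransform μ s (r • x) - cosTransform μ s (√n • x) + (r - √n) * A| ≤
      2 * s ^ 2 * (r - √n) ^ 2 := by
    intro r
    have e1 : cosTransform μ s (r • x) - cosTransform μ s (√n • x) + (r - √n) * A =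
        ∫ y, (cos (r * (s * inner ℝ y x)) - cos (√n * (s * inner ℝ y x)) +
          (r - √n) * (s * inner ℝ y x * sin (√n * (s * inner ℝ y x)))) ∂μ := by
      rw [hk, hk, hA, ← integral_const_mul, ← integral_sub (hci r) (hci _),
        ← integral_add
        (f := fun y => cos (r * (s * inner ℝ y x)) - cos (√n * (s * inner ℝ y x)))
        ((hci r).sub (hci _)) (hAi.const_mul _)]
    calc _ ≤ ∫ y, 2 * s ^ 2 * (r - √n) ^ 2 * inner ℝ y x ^ 2 ∂μ := by
          rw [e1]
          refine abs_integral_le_of_abs_le (hin2.const_mul _) fun y => ?_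
          have e2 := abs_cos_add_sub_le (√n * (s * inner ℝ y x)) ((r - √n) * (s * inner ℝ y x))
          rw [show √n * (s * inner ℝ y x) + (r - √n) * (s * inner ℝ y x) = r * (s * inner ℝ y x)
            by ring] at e2
          calc _ = |cos (r * (s * inner ℝ y x)) - cos (√n * (s * inner ℝ y x)) +
              (r - √n) * (s * inner ℝ y x) * sin (√n * (s * inner ℝ y x))| := by ring_nf
            _ ≤ _ := e2
            _ = _ := by ring
      _ = _ := by rw [integral_const_mul, hμ.integral_inner_sq, hx]; ring
  have hri : Integrable (fun r : Set.Ioi (0 : ℝ) => (r : ℝ)) ν :=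
    integrable_radius h continuous_id (by simpa using integrable_norm_pow_stdGaussian 1)
  have hri2 : Integrable (fun r : Set.Ioi (0 : ℝ) => (r : ℝ) ^ 2) ν :=
    integrable_radius h (k := fun r => r ^ 2) (by fun_prop) (integrable_norm_pow_stdGaussian 2)
  have hrd : Integrable (fun r : Set.Ioi (0 : ℝ) => ((r : ℝ) - √n) ^ 2) ν := by
    have e : ∀ r : ℝ, (r - √n) ^ 2 = r ^ 2 - 2 * √n * r + √n ^ 2 := fun r => by ring
    simp_rw [e]
    exact (hri2.sub (hri.const_mul _)).add (integrable_const _)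
  set V := ∫ r : Set.Ioi (0 : ℝ), ((r : ℝ) - √n) ^ 2 ∂ν with hV
  have hV10 : V ≤ 10 := integral_radius_sub_sq_le hn h
  have hV0 : 0 ≤ V := integral_nonneg fun _ => sq_nonneg _
  have hm2 : ∫ r : Set.Ioi (0 : ℝ), (r : ℝ) ^ 2 ∂ν = n := by
    rw [integral_radius h (k := fun r => r ^ 2) (by fun_prop), integral_norm_sq_stdGaussian]
  -- Since `r²` has mean exactly `n`, the bias of `r` is of order `1 / √n`, which compensates the
  -- `√n` in `A`. The first order term is thus at most `s² V / 2`; with the remainder `2 s² V` and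
  -- `V ≤ 10` the total is `25 s²`.
  have hm : √n * ∫ r : Set.Ioi (0 : ℝ), ((r : ℝ) - √n) ∂ν = -(V / 2) := by
    have e : ∀ r : ℝ, (r - √n) ^ 2 = r ^ 2 - (n + 2 * √n * (r - √n)) := fun r => by
      nlinarith [sq_sqrt hn'.le]
    have hrs : Integrable (fun r : Set.Ioi (0 : ℝ) => 2 * √n * ((r : ℝ) - √n)) ν :=
      (hri.sub (integrable_const _)).const_mul _
    rw [hV]
    simp_rw [e]
    rw [integral_sub (g := fun r : Set.Ioi (0 : ℝ) => n + 2 * √n * ((r : ℝ) - √n)) hri2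
      ((integrable_const _).add hrs), integral_add (integrable_const _) hrs,
      hm2, integral_const_mul]
    simp
    ring
  have hcc : Continuous (cosTransform μ s) := continuous_cosTransform
  have hki : Integrable (fun r : Set.Ioi (0 : ℝ) => cosTransform μ s ((r : ℝ) • x)) ν :=
    .of_bound (Continuous.aestronglyMeasurable (by fun_prop)) 1
      (ae_of_all _ fun r => abs_cosTransform_le _)
  have hfin : |∫ r : Set.Ioi (0 : ℝ), cosTransform μ s ((r : ℝ) • x) ∂ν -
      cosTransform μ s (√n • x) + (∫ r : Set.Ioi (0 : ℝ), ((r : ℝ) - √n) ∂ν) * A| ≤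
      2 * s ^ 2 * V := by
    have hrA : Integrable (fun r : Set.Ioi (0 : ℝ) => ((r : ℝ) - √n) * A) ν :=
      (hri.sub (integrable_const _)).mul_const _
    have e : ∫ r : Set.Ioi (0 : ℝ), cosTransform μ s ((r : ℝ) • x) ∂ν -
        cosTransform μ s (√n • x) + (∫ r : Set.Ioi (0 : ℝ), ((r : ℝ) - √n) ∂ν) * A =
        ∫ r : Set.Ioi (0 : ℝ), (cosTransform μ s ((r : ℝ) • x) - cosTransform μ s (√n • x) +
          ((r : ℝ) - √n) * A) ∂ν := by
      rw [integral_add (f := fun r : Set.Ioi (0 : ℝ) => cosTransform μ s ((r : ℝ) • x) -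
        cosTransform μ s (√n • x)) (hki.sub (integrable_const _)) hrA,
        integral_sub hki (integrable_const _), integral_mul_const]
      simp
    rw [e, hV, ← integral_const_mul]
    exact abs_integral_le_of_abs_le (hrd.const_mul _) fun r => hr r
  have hsq : 0 < √(n : ℝ) := sqrt_pos.2 hn'
  have hmA : |(∫ r : Set.Ioi (0 : ℝ), ((r : ℝ) - √n) ∂ν) * A| ≤ s ^ 2 * (V / 2) := by
    rw [abs_mul]
    calc _ ≤ |∫ r : Set.Ioi (0 : ℝ), ((r : ℝ) - √n) ∂ν| * (s ^ 2 * √n) := by gcongr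
      _ = s ^ 2 * |√n * ∫ r : Set.Ioi (0 : ℝ), ((r : ℝ) - √n) ∂ν| := by
          rw [abs_mul, abs_of_pos hsq]; ring
      _ = _ := by rw [hm, abs_neg, abs_of_nonneg (by positivity)]
  have hs2 : 0 ≤ s ^ 2 := sq_nonneg s
  have hfin' := abs_le.1 hfin
  have hmA' := abs_le.1 hmA
  have : s ^ 2 * V ≤ s ^ 2 * 10 := by gcongr
  rw [abs_le]
  constructor <;> linarith

end Sphere

end WeightedSums

namespace WeightedSums

/-! ### Concentration on the sphere. -/

section SphereConcentration

open Real

variable {n : ℕ} {μ : Measure (EuclideanSpace ℝ (Fin n))} {L : ℝ} {s t : ℝ}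

/-- Deviation of the characteristic function on the sphere from its spherical mean. -/
noncomputable def sphereDev (μ : Measure (EuclideanSpace ℝ (Fin n))) (t : ℝ)
    (θ : Metric.sphere (0 : EuclideanSpace ℝ (Fin n)) 1) : ℝ :=
  cosTransform μ t θ - ∫ η : Metric.sphere (0 : EuclideanSpace ℝ (Fin n)) 1,
    cosTransform μ t η ∂(sphereUniform n)

lemma continuous_sphereDev [IsProbabilityMeasure μ] : Continuous (sphereDev μ t) :=
  (continuous_cosTransform.comp continuous_subtype_val).sub continuous_const

lemma integrable_cosTransform_sphere [IsProbabilityMeasure μ]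
    [IsProbabilityMeasure (sphereUniform n)] :
    Integrable (fun η : Metric.sphere (0 : EuclideanSpace ℝ (Fin n)) 1 => cosTransform μ t η)
      (sphereUniform n) :=
  .of_bound (continuous_cosTransform.comp continuous_subtype_val).aestronglyMeasurable 1
    (ae_of_all _ fun _ => abs_cosTransform_le _)

lemma abs_sphereDev_le_two [IsProbabilityMeasure μ] [IsProbabilityMeasure (sphereUniform n)]
    (θ : Metric.sphere (0 : EuclideanSpace ℝ (Fin n)) 1) : |sphereDev μ t θ| ≤ 2 := by
  have h1 := abs_le.1 (abs_cosTransform_le (μ := μ) (s := t) (θ : EuclideanSpace ℝ (Fin n)))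
  have h2 : |∫ η : Metric.sphere (0 : EuclideanSpace ℝ (Fin n)) 1,
      cosTransform μ t η ∂(sphereUniform n)| ≤ ∫ η, 1 ∂(sphereUniform n) :=
    abs_integral_le_of_abs_le (integrable_const _) fun _ => abs_cosTransform_le _
  simp only [integral_const, probReal_univ, smul_eq_mul, mul_one] at h2
  have h3 := abs_le.1 h2
  rw [abs_le, sphereDev]
  constructor <;> linarith

/-- Elementary bound on the deviation, effective when the dimension is bounded. -/
lemma IsSecondOrderIsotropic.abs_sphereDev_le_sq [IsProbabilityMeasure μ]
    [IsProbabilityMeasure (sphereUniform n)] (hμ : IsSecondOrderIsotropic μ L)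
    (θ : Metric.sphere (0 : EuclideanSpace ℝ (Fin n)) 1) : |sphereDev μ t θ| ≤ t ^ 2 := by
  have h : ∀ η : Metric.sphere (0 : EuclideanSpace ℝ (Fin n)) 1,
      1 - t ^ 2 ≤ cosTransform μ t η := by
    intro η
    have hη : ‖(η : EuclideanSpace ℝ (Fin n))‖ = 1 := by simp
    have hi : Integrable (fun y => inner ℝ y (η : EuclideanSpace ℝ (Fin n)) ^ 2) μ := by
      simpa [sq] using hμ.integrable_inner_mul_inner η η
    have h1 : ∫ y, (1 - t ^ 2 * inner ℝ y (η : EuclideanSpace ℝ (Fin n)) ^ 2) ∂μ ≤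
        cosTransform μ t η := by
      refine integral_mono ((integrable_const _).sub (hi.const_mul _))
        (.of_bound (Continuous.aestronglyMeasurable (by fun_prop)) 1
          (ae_of_all _ fun y => abs_cos_le_one _)) fun y => ?_
      have := one_sub_sq_div_two_le_cos (x := t * inner ℝ y (η : EuclideanSpace ℝ (Fin n)))
      rw [mul_pow] at this
      have h0 : 0 ≤ t ^ 2 * inner ℝ y (η : EuclideanSpace ℝ (Fin n)) ^ 2 := by positivity
      linarith
    rw [integral_sub (integrable_const _) (hi.const_mul _), integral_const_mul,
      hμ.integral_inner_sq, hη] at h1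
    simpa using h1
  have h' : ∀ η : Metric.sphere (0 : EuclideanSpace ℝ (Fin n)) 1, cosTransform μ t η ≤ 1 :=
    fun η => (abs_le.1 (abs_cosTransform_le _)).2
  have e1 : 1 - t ^ 2 ≤ ∫ η : Metric.sphere (0 : EuclideanSpace ℝ (Fin n)) 1,
      cosTransform μ t η ∂(sphereUniform n) := by
    have := integral_mono (μ := sphereUniform n) (integrable_const (1 - t ^ 2))
      integrable_cosTransform_sphere h
    simpa using this
  have e2 : ∫ η : Metric.sphere (0 : EuclideanSpace ℝ (Fin n)) 1,
      cosTransform μ t η ∂(sphereUniform n) ≤ 1 := by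
    have := integral_mono (μ := sphereUniform n) integrable_cosTransform_sphere
      (integrable_const (1 : ℝ)) h'
    simpa using this
  rw [abs_le, sphereDev]
  constructor <;> linarith [h θ, h' θ]

lemma cosTransform_smul (x : EuclideanSpace ℝ (Fin n)) (r : ℝ) :
    cosTransform μ s (r • x) = cosTransform μ (s * r) x := by
  simp only [cosTransform, inner_smul_right, mul_assoc]

/-- The deviation on the sphere is dominated by the radial average of the Gaussian deviation. -/
lemma IsSecondOrderIsotropic.abs_sphereDev_le_radial [IsProbabilityMeasure μ]
    [IsProbabilityMeasure (sphereUniform n)] (hμ : IsSecondOrderIsotropic μ L) (hn : 0 < n)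
    {ν : Measure (Set.Ioi (0 : ℝ))} [IsProbabilityMeasure ν] (hν : MeasurePreserving
      (fun p : Metric.sphere (0 : EuclideanSpace ℝ (Fin n)) 1 × Set.Ioi (0 : ℝ) =>
        (p.2 : ℝ) • (p.1 : EuclideanSpace ℝ (Fin n)))
      ((sphereUniform n).prod ν) (stdGaussian (EuclideanSpace ℝ (Fin n))))
    (θ : Metric.sphere (0 : EuclideanSpace ℝ (Fin n)) 1) :
    |sphereDev μ (s * √n) θ| ≤
      |∫ r : Set.Ioi (0 : ℝ), (defect μ s ((r : ℝ) • (θ : EuclideanSpace ℝ (Fin n))) -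
        ∫ x, defect μ s x ∂(stdGaussian (EuclideanSpace ℝ (Fin n)))) ∂ν| + 50 * s ^ 2 := by
  have hrad := map_coe_eq_map_norm hν
  set m := ∫ x, defect μ s x ∂(stdGaussian (EuclideanSpace ℝ (Fin n))) with hm
  set D : Metric.sphere (0 : EuclideanSpace ℝ (Fin n)) 1 → ℝ := fun θ =>
    ∫ r : Set.Ioi (0 : ℝ), (defect μ s ((r : ℝ) • (θ : EuclideanSpace ℝ (Fin n))) - m) ∂ν with hD
  -- The radial average of the Gaussian term is the same constant in every direction, so it
  -- disappears from the deviation.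
  set q := ∫ r : Set.Ioi (0 : ℝ), exp (-(s ^ 2 * (r : ℝ) ^ 2 / 2)) ∂ν with hq
  have hdc : Continuous (defect μ s) := hμ.continuous_defect
  have hcc : Continuous (cosTransform μ s) := continuous_cosTransform
  have hgc : Continuous (gaussTransform (n := n) s) := continuous_gaussTransform
  have hprod : Integrable (fun p : Metric.sphere (0 : EuclideanSpace ℝ (Fin n)) 1 ×
      Set.Ioi (0 : ℝ) => defect μ s ((p.2 : ℝ) • (p.1 : EuclideanSpace ℝ (Fin n))) - m)
      ((sphereUniform n).prod ν) :=
    (Integrable.of_bound (Continuous.aestronglyMeasurable (by fun_prop)) 2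
      (ae_of_all _ fun p => abs_defect_le _)).sub (integrable_const _)
  have hDi : Integrable D (sphereUniform n) := hprod.integral_prod_left
  have hD0 : ∫ η, D η ∂(sphereUniform n) = 0 := by
    rw [hD, ← integral_prod _ hprod]
    have h1 : ∫ x, (defect μ s x - m) ∂(stdGaussian (EuclideanSpace ℝ (Fin n))) = 0 := by
      rw [integral_sub (hμ.memLp_defect.integrable (by norm_num)) (integrable_const _)]
      simp [hm]
    rw [← hν.map_eq, integral_map hν.measurable.aemeasurable
      (Continuous.aestronglyMeasurable (by fun_prop))] at h1
    exact h1
  have he : ∀ η : Metric.sphere (0 : EuclideanSpace ℝ (Fin n)) 1,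
      |cosTransform μ (s * √n) η - (D η + (m + q))| ≤ 25 * s ^ 2 := by
    intro η
    have hη : ‖(η : EuclideanSpace ℝ (Fin n))‖ = 1 := by simp
    have h1 := hμ.abs_integral_radius_cosTransform_sub_le (s := s) hn hrad η hη
    have h2 : ∫ r : Set.Ioi (0 : ℝ), cosTransform μ s ((r : ℝ) • (η : EuclideanSpace ℝ (Fin n))) ∂ν
        = D η + (m + q) := by
      have i1 : Integrable (fun r : Set.Ioi (0 : ℝ) =>
          cosTransform μ s ((r : ℝ) • (η : EuclideanSpace ℝ (Fin n)))) ν :=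
        .of_bound (Continuous.aestronglyMeasurable (by fun_prop)) 1
          (ae_of_all _ fun r => abs_cosTransform_le _)
      have i2 : Integrable (fun r : Set.Ioi (0 : ℝ) =>
          gaussTransform s ((r : ℝ) • (η : EuclideanSpace ℝ (Fin n)))) ν :=
        .of_bound (Continuous.aestronglyMeasurable (by fun_prop)) 1
          (ae_of_all _ fun r => by
            rw [norm_eq_abs, abs_of_pos (gaussTransform_pos _)]; exact gaussTransform_le_one _)
      have h3 : ∫ r : Set.Ioi (0 : ℝ),
          gaussTransform s ((r : ℝ) • (η : EuclideanSpace ℝ (Fin n))) ∂ν = q := by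
        refine integral_congr_ae (ae_of_all _ fun r => ?_)
        simp only [gaussTransform, norm_smul, hη, mul_one, norm_eq_abs, sq_abs]
      simp only [hD, defect]
      rw [integral_sub (f := fun r : Set.Ioi (0 : ℝ) =>
        cosTransform μ s ((r : ℝ) • (η : EuclideanSpace ℝ (Fin n))) -
        gaussTransform s ((r : ℝ) • (η : EuclideanSpace ℝ (Fin n)))) (i1.sub i2)
        (integrable_const _), integral_sub i1 i2, h3]
      simp
      ring
    rwa [h2, cosTransform_smul, abs_sub_comm] at h1
  -- `D` has spherical mean zero, so the mean is within `25 s²` of `m + q`; together with the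
  -- pointwise error this gives `50 s²`.
  have hmean : |∫ η : Metric.sphere (0 : EuclideanSpace ℝ (Fin n)) 1,
      cosTransform μ (s * √n) η ∂(sphereUniform n) - (m + q)| ≤ 25 * s ^ 2 := by
    have h1 : ∫ η : Metric.sphere (0 : EuclideanSpace ℝ (Fin n)) 1,
        cosTransform μ (s * √n) η ∂(sphereUniform n) - (m + q) =
        ∫ η : Metric.sphere (0 : EuclideanSpace ℝ (Fin n)) 1,
          (cosTransform μ (s * √n) η - (D η + (m + q))) ∂(sphereUniform n) := by
      rw [integral_sub (g := fun η => D η + (m + q)) integrable_cosTransform_sphere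
        (hDi.add (integrable_const _)),
        integral_add hDi (integrable_const _), hD0]
      simp
    rw [h1]
    refine (abs_integral_le_of_abs_le (integrable_const (25 * s ^ 2)) he).trans_eq ?_
    simp
  have h1 := abs_le.1 (he θ)
  have h2 := abs_le.1 hmean
  have h3 := abs_le.1 (le_refl |D θ|)
  rw [abs_le, sphereDev]
  constructor <;> linarith

/-- Concentration of the characteristic function on the sphere for small `s = t / √n`. -/
lemma IsSecondOrderIsotropic.sphereDev_concentration [IsProbabilityMeasure μ]
    (hμ : IsSecondOrderIsotropic μ L) (hn : 0 < n) (hs : s ≠ 0) (hsn : s ^ 4 * n ≤ 1 / 40) :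
    ∫ θ, sphereDev μ (s * √n) θ ^ 2 ∂(sphereUniform n) ≤ 6800 * s ^ 4 * L ∧
    ∫ θ, exp ((40 * s ^ 2 * L)⁻¹ * |sphereDev μ (s * √n) θ|) ∂(sphereUniform n) ≤ 48 := by
  have hL := hμ.one_le
  obtain ⟨hσ, ν, hνp, hν⟩ := exists_polar_stdGaussian hn
  set m := ∫ x, defect μ s x ∂(stdGaussian (EuclideanSpace ℝ (Fin n))) with hm
  have hdc : Continuous (defect μ s) := hμ.continuous_defect
  set D : Metric.sphere (0 : EuclideanSpace ℝ (Fin n)) 1 → ℝ := fun θ =>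
    ∫ r : Set.Ioi (0 : ℝ), (defect μ s ((r : ℝ) • (θ : EuclideanSpace ℝ (Fin n))) - m) ∂ν with hD
  have hdev : ∀ θ, |sphereDev μ (s * √n) θ| ≤ |D θ| + 50 * s ^ 2 := fun θ =>
    hμ.abs_sphereDev_le_radial hn hν θ
  have hb : ∀ x, |defect μ s x - m| ≤ 4 := fun x => by
    have h1 := abs_defect_le (μ := μ) (s := s) x
    have h2 : |m| ≤ ∫ _, 2 ∂(stdGaussian (EuclideanSpace ℝ (Fin n))) :=
      abs_integral_le_of_abs_le (integrable_const _) abs_defect_le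
    simp only [integral_const, probReal_univ, smul_eq_mul, one_mul] at h2
    linarith [abs_sub (defect μ s x) m]
  -- Jensen in the radius, then Fubini back to the Gaussian integral. It is used for `y²` and for
  -- `exp (l |y|)`.
  have hfib : ∀ (k : ℝ → ℝ), Continuous k → ConvexOn ℝ Set.univ k →
      Integrable (fun θ : Metric.sphere (0 : EuclideanSpace ℝ (Fin n)) 1 => ∫ r : Set.Ioi (0 : ℝ),
        k (defect μ s ((r : ℝ) • (θ : EuclideanSpace ℝ (Fin n))) - m) ∂ν) (sphereUniform n) ∧
      (∀ θ, k (D θ) ≤ ∫ r : Set.Ioi (0 : ℝ),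
        k (defect μ s ((r : ℝ) • (θ : EuclideanSpace ℝ (Fin n))) - m) ∂ν) ∧
      ∫ θ : Metric.sphere (0 : EuclideanSpace ℝ (Fin n)) 1, ∫ r : Set.Ioi (0 : ℝ),
        k (defect μ s ((r : ℝ) • (θ : EuclideanSpace ℝ (Fin n))) - m) ∂ν ∂(sphereUniform n) =
      ∫ x, k (defect μ s x - m) ∂(stdGaussian (EuclideanSpace ℝ (Fin n))) := by
    intro k hk hkconv
    obtain ⟨C, hC⟩ := (isCompact_Icc (a := (-4 : ℝ)) (b := 4)).exists_bound_of_continuousOn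
      hk.continuousOn
    have hC' : ∀ x, ‖k (defect μ s x - m)‖ ≤ C := fun x =>
      hC _ (abs_le.1 (hb x))
    have hprod : Integrable (fun p : Metric.sphere (0 : EuclideanSpace ℝ (Fin n)) 1 ×
        Set.Ioi (0 : ℝ) => k (defect μ s ((p.2 : ℝ) • (p.1 : EuclideanSpace ℝ (Fin n))) - m))
        ((sphereUniform n).prod ν) :=
      .of_bound (Continuous.aestronglyMeasurable (by fun_prop)) C (ae_of_all _ fun p => hC' _)
    refine ⟨hprod.integral_prod_left, fun θ => ?_, ?_⟩
    · refine hkconv.map_integral_le hk.continuousOn isClosed_univ (by simp) ?_ ?_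
      · exact .of_bound (Continuous.aestronglyMeasurable (by fun_prop)) 4
          (ae_of_all _ fun r => hb _)
      · exact .of_bound (Continuous.aestronglyMeasurable (by fun_prop)) C
          (ae_of_all _ fun r => hC' _)
    · rw [← integral_prod _ hprod, ← hν.map_eq, integral_map hν.measurable.aemeasurable
        (Continuous.aestronglyMeasurable (by fun_prop))]
  constructor
  · obtain ⟨h1, h2, h3⟩ := hfib (fun y => y ^ 2) (by fun_prop) (Even.convexOn_pow even_two)
    have h4 := hμ.integral_sub_mean_defect_sq_le hn hs hsn
    calc ∫ θ, sphereDev μ (s * √n) θ ^ 2 ∂(sphereUniform n)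
        ≤ ∫ θ : Metric.sphere (0 : EuclideanSpace ℝ (Fin n)) 1, (2 * (∫ r : Set.Ioi (0 : ℝ),
          (defect μ s ((r : ℝ) • (θ : EuclideanSpace ℝ (Fin n))) - m) ^ 2 ∂ν) + 5000 * s ^ 4)
            ∂(sphereUniform n) := by
          refine integral_mono_of_nonneg (ae_of_all _ fun θ => sq_nonneg _)
            ((h1.const_mul 2).add (integrable_const _)) (ae_of_all _ fun θ => ?_)
          have e1 := hdev θ
          have e2 := h2 θ
          have e3 : sphereDev μ (s * √n) θ ^ 2 ≤ (|D θ| + 50 * s ^ 2) ^ 2 := by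
            rw [← sq_abs]; gcongr
          simp only at e2 ⊢
          nlinarith [sq_nonneg (|D θ| - 50 * s ^ 2), sq_abs (D θ)]
      _ = 2 * (∫ x, (defect μ s x - m) ^ 2 ∂(stdGaussian (EuclideanSpace ℝ (Fin n)))) +
          5000 * s ^ 4 := by
          rw [integral_add (h1.const_mul 2) (integrable_const _), integral_const_mul, h3]
          simp
      _ ≤ 2 * (900 * s ^ 4 * L) + 5000 * s ^ 4 * L := by
          have : s ^ 4 ≤ s ^ 4 * L := le_mul_of_one_le_right (by positivity) hL
          linarith
      _ = _ := by ring
  · set l := (40 * s ^ 2 * L)⁻¹ with hl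
    have hl0 : 0 ≤ l := by positivity
    have hconv : ConvexOn ℝ Set.univ fun y : ℝ => exp (l * |y|) := by
      refine ⟨convex_univ, fun x _ y _ a b ha hb hab => ?_⟩
      refine le_trans ?_ (convexOn_exp.2 (Set.mem_univ (l * |x|)) (Set.mem_univ (l * |y|))
        ha hb hab)
      rw [exp_le_exp]
      simp only [smul_eq_mul]
      calc l * |a * x + b * y| ≤ l * (|a * x| + |b * y|) := by
            gcongr; exact abs_add_le _ _
        _ = _ := by rw [abs_mul, abs_mul, abs_of_nonneg ha, abs_of_nonneg hb]; ring
    obtain ⟨h1, h2, h3⟩ := hfib (fun y => exp (l * |y|)) (by fun_prop) hconv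
    have h4 := hμ.integral_exp_abs_sub_mean_defect_le hn hs hsn
    -- The exponent is `50 / (40 L) ≤ 5 / 4`, so the radial error costs only a constant factor.
    have h5 : exp (l * (50 * s ^ 2)) ≤ 4 := by
      have e1 : l * (50 * s ^ 2) = 5 / 4 * L⁻¹ := by rw [hl]; field_simp; norm_num
      have e2 : L⁻¹ ≤ 1 := inv_le_one_of_one_le₀ hL
      have e3 : exp (5 / 4 : ℝ) ≤ 4 := by
        have : exp (5 / 4 : ℝ) ^ 4 ≤ 4 ^ 4 := by
          rw [← exp_nat_mul]
          have e4 : exp (((4 : ℕ) : ℝ) * (5 / 4)) = exp 1 ^ 5 := by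
            rw [← exp_nat_mul]; norm_num
          rw [e4]
          calc exp 1 ^ 5 ≤ 2.7182818286 ^ 5 := by
                gcongr; exact exp_one_lt_d9.le
            _ ≤ _ := by norm_num
        exact (pow_le_pow_iff_left₀ (exp_pos _).le (by norm_num) (by norm_num)).1 this
      refine le_trans (exp_le_exp.2 ?_) e3
      rw [e1]; linarith
    calc ∫ θ, exp (l * |sphereDev μ (s * √n) θ|) ∂(sphereUniform n)
        ≤ ∫ θ : Metric.sphere (0 : EuclideanSpace ℝ (Fin n)) 1, 4 * (∫ r : Set.Ioi (0 : ℝ),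
          exp (l * |defect μ s ((r : ℝ) • (θ : EuclideanSpace ℝ (Fin n))) - m|) ∂ν)
            ∂(sphereUniform n) := by
          refine integral_mono_of_nonneg (ae_of_all _ fun θ => (exp_pos _).le)
            (h1.const_mul 4) (ae_of_all _ fun θ => ?_)
          have e2 := h2 θ
          simp only at e2 ⊢
          calc exp (l * |sphereDev μ (s * √n) θ|) ≤ exp (l * (|D θ| + 50 * s ^ 2)) := by
                gcongr; exact hdev θ
            _ = exp (l * (50 * s ^ 2)) * exp (l * |D θ|) := by rw [← exp_add]; ring_nf
            _ ≤ _ := by gcongr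
      _ ≤ 4 * 12 := by
          rw [integral_const_mul, h3]
          gcongr
      _ = 48 := by norm_num

/-- Scaling down the exponent in an exponential moment bound. -/
lemma integral_exp_le_two_of_le {Ω : Type*} [MeasurableSpace Ω] {P : Measure Ω}
    [IsProbabilityMeasure P] {k : Ω → ℝ} {ε C : ℝ} (hε0 : 0 ≤ ε) (hε1 : ε ≤ 1)
    (hk : Integrable (fun ω => exp (k ω)) P) (hC : ∫ ω, exp (k ω) ∂P ≤ C)
    (hεC : ε * (C - 1) ≤ 1) : ∫ ω, exp (ε * k ω) ∂P ≤ 2 := by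
  calc ∫ ω, exp (ε * k ω) ∂P ≤ ∫ ω, ((1 - ε) + ε * exp (k ω)) ∂P := by
        refine integral_mono_of_nonneg (ae_of_all _ fun _ => (exp_pos _).le)
          ((integrable_const _).add (hk.const_mul _)) (ae_of_all _ fun ω => ?_)
        have h := convexOn_exp.2 (Set.mem_univ 0) (Set.mem_univ (k ω))
          (show 0 ≤ 1 - ε by linarith) hε0 (by ring)
        simpa using h
    _ = (1 - ε) + ε * ∫ ω, exp (k ω) ∂P := by
        rw [integral_add (integrable_const _) (hk.const_mul _), integral_const_mul]
        simp
    _ ≤ (1 - ε) + ε * C := by gcongr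
    _ ≤ 2 := by linarith

lemma integrable_exp_sphereDev [IsProbabilityMeasure μ] [IsProbabilityMeasure (sphereUniform n)]
    {b : ℝ} (hb : 0 ≤ b) :
    Integrable (fun θ => exp (b * |sphereDev μ t θ|)) (sphereUniform n) := by
  have := continuous_sphereDev (μ := μ) (t := t)
  refine .of_bound (Continuous.aestronglyMeasurable (by fun_prop)) (exp (b * 2))
    (ae_of_all _ fun θ => ?_)
  rw [norm_eq_abs, abs_exp]
  gcongr
  exact abs_sphereDev_le_two θ

lemma integrable_sphereDev_sq [IsProbabilityMeasure μ] [IsProbabilityMeasure (sphereUniform n)] :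
    Integrable (fun θ => sphereDev μ t θ ^ 2) (sphereUniform n) :=
  (memLp_two_of_bound continuous_sphereDev.aestronglyMeasurable abs_sphereDev_le_two).integrable_sq

/-- Concentration of the characteristic function of a second order isotropic law around its
spherical mean. -/
theorem IsSecondOrderIsotropic.sphereDev_bounds [IsProbabilityMeasure μ]
    (hμ : IsSecondOrderIsotropic μ L) (hn : 0 < n) (ht : t ≠ 0)
    (htn : |t| ≤ (n : ℝ) ^ ((1 : ℝ) / 6)) :
    ∫ θ, sphereDev μ t θ ^ 2 ∂(sphereUniform n) ≤ 5000000000 / (n : ℝ) ^ 2 * L * t ^ 4 ∧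
    ∫ θ, exp (n / (5000000000 * L * t ^ 2) * |sphereDev μ t θ|) ∂(sphereUniform n) ≤ 2 := by
  have hL := hμ.one_le
  have hσ := (exists_polar_stdGaussian hn).1
  have hn' : (0 : ℝ) < n := by exact_mod_cast hn
  have ht4 : 0 < t ^ 4 := by positivity
  have ht2 : 0 < t ^ 2 := by positivity
  -- This is the smallness condition `s⁴ n ≤ 1 / 40`. If it fails, `t¹² ≤ n²` forces `n ≤ 40³ =
  -- 64000`.
  by_cases hcase : t ^ 4 / n ≤ 1 / 40
  · set s := t / √n with hs
    have hsq : 0 < √(n : ℝ) := sqrt_pos.2 hn'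
    have hst : s * √n = t := by rw [hs]; field_simp
    have hs0 : s ≠ 0 := div_ne_zero ht hsq.ne'
    have hs2 : s ^ 2 = t ^ 2 / n := by rw [hs, div_pow, sq_sqrt hn'.le]
    have hs4 : s ^ 4 = t ^ 4 / n ^ 2 := by
      rw [show s ^ 4 = (s ^ 2) ^ 2 by ring, hs2]; ring
    have hsn : s ^ 4 * n ≤ 1 / 40 := by
      rw [hs4]
      convert hcase using 1
      field_simp
    obtain ⟨h1, h2⟩ := hμ.sphereDev_concentration hn hs0 hsn
    rw [hst] at h1 h2
    constructor
    · refine h1.trans ?_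
      rw [hs4, show 6800 * (t ^ 4 / (n : ℝ) ^ 2) * L = 6800 / (n : ℝ) ^ 2 * L * t ^ 4 by ring]
      gcongr
      norm_num
    -- Shrinking the exponent by `ε` lowers the bound `48` to `2`, as `47 ε ≤ 1`.
    · have h3 := integral_exp_le_two_of_le (ε := 40 / 5000000000) (by norm_num) (by norm_num)
        (integrable_exp_sphereDev (by positivity)) h2 (by norm_num)
      refine le_of_eq_of_le (integral_congr_ae (ae_of_all _ fun θ => ?_)) h3
      simp only
      rw [hs2, ← mul_assoc]
      congr 2
      field_simp
  · have hnle : (n : ℝ) ≤ 64000 := by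
      by_contra! hgt
      apply hcase
      have e1 : t ^ 12 ≤ n ^ 2 := by
        have : |t| ^ 12 ≤ ((n : ℝ) ^ ((1 : ℝ) / 6)) ^ 12 := by gcongr
        rw [← rpow_natCast ((n : ℝ) ^ ((1 : ℝ) / 6)), ← rpow_mul hn'.le] at this
        norm_num at this
        rwa [pow_abs, abs_of_nonneg (by positivity)] at this
      rw [div_le_iff₀ hn']
      have e2 : (t ^ 4) ^ 3 ≤ (1 / 40 * (n : ℝ)) ^ 3 := by
        rw [← pow_mul]
        calc t ^ 12 ≤ (n : ℝ) ^ 2 := e1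
          _ ≤ (n : ℝ) ^ 2 * (n / 64000) := le_mul_of_one_le_right (by positivity)
              ((one_le_div (by norm_num)).2 hgt.le)
          _ = _ := by ring
      exact (pow_le_pow_iff_left₀ ht4.le (by positivity) (by norm_num)).1 e2
    -- In bounded dimension this is enough, because `64000² ≤ 5000000000`; this case dictates the
    -- final constant.
    have hdev : ∀ θ, |sphereDev μ t θ| ≤ t ^ 2 := fun θ => hμ.abs_sphereDev_le_sq θ
    constructor
    · calc ∫ θ, sphereDev μ t θ ^ 2 ∂(sphereUniform n) ≤ ∫ _, t ^ 4 ∂(sphereUniform n) := by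
            refine integral_mono integrable_sphereDev_sq (integrable_const _) fun θ => ?_
            have := hdev θ
            calc sphereDev μ t θ ^ 2 = |sphereDev μ t θ| ^ 2 := (sq_abs _).symm
              _ ≤ (t ^ 2) ^ 2 := by gcongr
              _ = _ := by ring
        _ = 1 * 1 * t ^ 4 := by simp
        _ ≤ _ := by
            gcongr
            rw [one_le_div (by positivity)]
            nlinarith
    · calc _ ≤ ∫ _, (2 : ℝ) ∂(sphereUniform n) := by
            refine integral_mono (integrable_exp_sphereDev (by positivity)) (integrable_const _)
              fun θ => ?_
            have e1 : n / (5000000000 * L * t ^ 2) * |sphereDev μ t θ| ≤ 1 / 2 := by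
              calc n / (5000000000 * L * t ^ 2) * |sphereDev μ t θ|
                  ≤ 64000 / (5000000000 * 1 * t ^ 2) * t ^ 2 := by
                    gcongr
                    exact hdev θ
                _ = 64000 / 5000000000 := by field_simp
                _ ≤ _ := by norm_num
            refine (exp_le_exp.2 e1).trans ?_
            have : exp (1 / 2 : ℝ) ^ 2 ≤ 2 ^ 2 := by
              rw [← exp_nat_mul]
              norm_num
              linarith [exp_one_lt_d9]
            exact (pow_le_pow_iff_left₀ (exp_pos _).le (by norm_num) (by norm_num)).1 this
        _ = 2 := by simp

end SphereConcentration

end WeightedSums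

namespace WeightedSums

/-! ### From the random vector to its law. -/

section Law

open Real

variable {n : ℕ} {Ω : Type*} [MeasurableSpace Ω] {P : Measure Ω}
  {X : Ω → EuclideanSpace ℝ (Fin n)}

/-- The optimal constant is attained. -/
lemma secondOrderCorrelation_corrConst (h : corrConst X P < ∞) :
    SecondOrderCorrelation X P (corrConst X P) := by
  intro a
  obtain ⟨L₀, hL₀, _⟩ := sInf_lt_iff.1 h
  set c := ENNReal.ofReal (∑ i, ∑ j, a i j ^ 2) with hc
  by_cases h0 : c = 0
  · have := hL₀ a
    rw [← hc, h0, mul_zero] at this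
    exact this.trans bot_le
  · rw [← ENNReal.div_le_iff h0 ENNReal.ofReal_ne_top]
    exact le_sInf fun L hL => (ENNReal.div_le_iff h0 ENNReal.ofReal_ne_top).2 (hL a)

lemma memLp_map_coord (hX : AEMeasurable X P) (hiso : IsIsotropic X P) (i : Fin n) :
    MemLp (fun y : EuclideanSpace ℝ (Fin n) => y i) 2 (P.map X) :=
  (memLp_map_measure_iff (by fun_prop) hX).2 (hiso.memLp i)

lemma integral_map_coord_mul_coord [IsProbabilityMeasure P] (hX : AEMeasurable X P)
    (hiso : IsIsotropic X P) (i j : Fin n) :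
    ∫ y, y i * y j ∂(P.map X) = if i = j then 1 else 0 := by
  rw [integral_map hX (by fun_prop)]
  split_ifs with hij
  · subst hij
    have h := hiso.variance_eq_one i
    rw [variance_of_integral_eq_zero (hiso.memLp i).aemeasurable (hiso.mean_eq_zero i)] at h
    simpa [sq] using h
  · have h := hiso.uncorrelated i j hij
    rw [covariance] at h
    simpa [hiso.mean_eq_zero] using h

lemma integrable_map_coord_mul_coord (hX : AEMeasurable X P)
    (hiso : IsIsotropic X P) (i j : Fin n) :
    Integrable (fun y : EuclideanSpace ℝ (Fin n) => y i * y j) (P.map X) :=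
  (memLp_map_coord hX hiso i).integrable_mul (memLp_map_coord hX hiso j)

lemma integral_map_quad [IsProbabilityMeasure P] (hX : AEMeasurable X P)
    (hiso : IsIsotropic X P) (a : Fin n → Fin n → ℝ) :
    ∫ y, ∑ i, ∑ j, a i j * y i * y j ∂(P.map X) = ∑ i, a i i := by
  have hi : ∀ i j : Fin n, Integrable (fun y : EuclideanSpace ℝ (Fin n) => a i j * y i * y j)
      (P.map X) := fun i j => by
    simp_rw [mul_assoc]
    exact (integrable_map_coord_mul_coord hX hiso i j).const_mul _
  rw [integral_finsetSum _ fun i _ => integrable_finsetSum _ fun j _ => hi i j]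
  refine Finset.sum_congr rfl fun i _ => ?_
  rw [integral_finsetSum _ fun j _ => hi i j]
  simp_rw [mul_assoc, integral_const_mul, integral_map_coord_mul_coord hX hiso]
  simp

/-- The second order correlation condition as a bound for the law of `X`. -/
lemma memLp_quad_and_integral_sq_le [IsProbabilityMeasure P] (hX : AEMeasurable X P)
    (hiso : IsIsotropic X P) (hL : corrConst X P < ∞) (a : Fin n → Fin n → ℝ) :
    MemLp (fun y : EuclideanSpace ℝ (Fin n) => ∑ i, ∑ j, a i j * y i * y j - ∑ i, a i i) 2
      (P.map X) ∧
    ∫ y, (∑ i, ∑ j, a i j * y i * y j - ∑ i, a i i) ^ 2 ∂(P.map X) ≤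
      (corrConst X P).toReal * ∑ i, ∑ j, a i j ^ 2 := by
  have hprob : IsProbabilityMeasure (P.map X) := Measure.isProbabilityMeasure_map hX
  have h := secondOrderCorrelation_corrConst hL a
  have hS : 0 ≤ ∑ i, ∑ j, a i j ^ 2 := by positivity
  have hfin : corrConst X P * ENNReal.ofReal (∑ i, ∑ j, a i j ^ 2) < ∞ :=
    ENNReal.mul_lt_top hL ENNReal.ofReal_lt_top
  have hcont : Continuous fun y : EuclideanSpace ℝ (Fin n) => ∑ i, ∑ j, a i j * y i * y j := by
    fun_prop
  have hQ : MemLp (fun ω => ∑ i, ∑ j, a i j * X ω i * X ω j) 2 P :=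
    (evariance_lt_top_iff_memLp (hcont.comp_aestronglyMeasurable hX.aestronglyMeasurable)).1
      (h.trans_lt hfin)
  have hQμ : MemLp (fun y : EuclideanSpace ℝ (Fin n) => ∑ i, ∑ j, a i j * y i * y j) 2 (P.map X) :=
    (memLp_map_measure_iff hcont.aestronglyMeasurable hX).2 hQ
  refine ⟨hQμ.sub (memLp_const _), ?_⟩
  have hmean := integral_map_quad hX hiso a
  have hv : variance (fun ω => ∑ i, ∑ j, a i j * X ω i * X ω j) P ≤
      (corrConst X P).toReal * ∑ i, ∑ j, a i j ^ 2 := by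
    rw [variance, ← ENNReal.toReal_ofReal hS, ← ENNReal.toReal_mul]
    exact ENNReal.toReal_mono hfin.ne h
  rw [variance_eq_integral hQ.aemeasurable] at hv
  rw [integral_map hX hcont.aestronglyMeasurable] at hmean
  rw [hmean] at hv
  rw [integral_map hX (Continuous.aestronglyMeasurable (by fun_prop))]
  exact hv

/-- Two coordinates suffice: `(y_k² + y_l²)² = (y_k² - y_l²)² + (2 y_k y_l)²`. The left side has
mean at least `2² = 4`. On the right both forms are centred with squared coefficients summing to
`2`, so the mean is at most `4 Λ`. -/
lemma one_le_corrConst [IsProbabilityMeasure P] (hX : AEMeasurable X P)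
    (hiso : IsIsotropic X P) (hL : corrConst X P < ∞) (hn : 2 ≤ n) :
    1 ≤ (corrConst X P).toReal := by
  have hprob : IsProbabilityMeasure (P.map X) := Measure.isProbabilityMeasure_map hX
  set k : Fin n := ⟨0, by omega⟩
  set l : Fin n := ⟨1, by omega⟩
  have hkl : k ≠ l := by simp [k, l]
  have hlk : l ≠ k := hkl.symm
  set e : Fin n → Fin n → Fin n → Fin n → ℝ := fun p q i j => if i = p ∧ j = q then 1 else 0 with he
  have hquad : ∀ (p q : Fin n) (y : EuclideanSpace ℝ (Fin n)),
      ∑ i, ∑ j, e p q i j * y i * y j = y p * y q := by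
    intro p q y
    simp [he, ite_and, Finset.sum_ite_eq']
  have hsum : ∀ p q : Fin n, ∑ i, ∑ j, e p q i j = 1 := by
    intro p q
    simp [he, ite_and, Finset.sum_ite_eq']
  have htr : ∀ p : Fin n, ∑ i, e p p i i = 1 := by
    intro p
    simp [he]
  have htr' : ∀ p q : Fin n, p ≠ q → ∑ i, e p q i i = 0 := by
    intro p q hpq
    refine Finset.sum_eq_zero fun i _ => ?_
    simp only [he]
    rw [if_neg]
    rintro ⟨rfl, h⟩
    exact hpq h
  have hsq : ∀ p q p' q' : Fin n, (p, q) ≠ (p', q') → ∀ i j,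
      (e p q i j - e p' q' i j) ^ 2 = e p q i j + e p' q' i j ∧
      (e p q i j + e p' q' i j) ^ 2 = e p q i j + e p' q' i j := by
    intro p q p' q' hne i j
    simp only [he]
    by_cases h1 : i = p ∧ j = q
    · rw [if_pos h1, if_neg (by
        rintro ⟨rfl, rfl⟩
        exact hne (by rw [h1.1, h1.2]))]
      norm_num
    · rw [if_neg h1]
      split_ifs <;> norm_num
  obtain ⟨hm1, h1⟩ := memLp_quad_and_integral_sq_le hX hiso hL
    (fun i j => e k k i j - e l l i j)
  obtain ⟨hm2, h2⟩ := memLp_quad_and_integral_sq_le hX hiso hL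
    (fun i j => e k l i j + e l k i j)
  simp only [sub_mul, add_mul, Finset.sum_sub_distrib, Finset.sum_add_distrib, hquad, htr,
    htr' k l hkl, htr' l k hlk, (hsq k k l l (by simp [hkl]) _ _).1,
    (hsq k l l k (by simp [hkl]) _ _).2, hsum, sub_self, sub_zero, add_zero] at hm1 h1 hm2 h2
  have hi : Integrable (fun y : EuclideanSpace ℝ (Fin n) => y k * y k + y l * y l) (P.map X) :=
    (integrable_map_coord_mul_coord hX hiso k k).add (integrable_map_coord_mul_coord hX hiso l l)
  have h3 : ∀ y : EuclideanSpace ℝ (Fin n), (y k * y k + y l * y l) ^ 2 =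
      (y k * y k - y l * y l) ^ 2 + (y k * y l + y l * y k) ^ 2 := fun y => by ring
  have hmem : MemLp (fun y : EuclideanSpace ℝ (Fin n) => y k * y k + y l * y l) 2 (P.map X) := by
    rw [memLp_two_iff_integrable_sq (by fun_prop)]
    simp_rw [h3]
    exact hm1.integrable_sq.add hm2.integrable_sq
  have h4 := sq_integral_le hmem
  simp_rw [h3] at h4
  rw [integral_add hm1.integrable_sq hm2.integrable_sq,
    integral_add (integrable_map_coord_mul_coord hX hiso k k)
      (integrable_map_coord_mul_coord hX hiso l l),
    integral_map_coord_mul_coord hX hiso, integral_map_coord_mul_coord hX hiso] at h4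
  norm_num at h4
  linarith

/-- The law of an isotropic vector with finite second order correlation constant. -/
lemma isSecondOrderIsotropic_map [IsProbabilityMeasure P] (hX : AEMeasurable X P)
    (hiso : IsIsotropic X P) (hL : corrConst X P < ∞) (hn : 2 ≤ n) :
    IsSecondOrderIsotropic (P.map X) (corrConst X P).toReal where
  integrable_norm_sq := by
    simp_rw [EuclideanSpace.real_norm_sq_eq]
    exact integrable_finsetSum _ fun i _ => (memLp_map_coord hX hiso i).integrable_sq
  integral_inner_sq v := by
    have h := integral_map_quad hX hiso fun i j => v i * v j
    rw [EuclideanSpace.real_norm_sq_eq]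
    simp_rw [sq (v _), ← h]
    refine integral_congr_ae (ae_of_all _ fun y => ?_)
    have : inner ℝ y v = ∑ i, v i * y i := by simp [PiLp.inner_apply]
    simp only [this, sq, Finset.sum_mul_sum]
    refine Finset.sum_congr rfl fun i _ => Finset.sum_congr rfl fun j _ => ?_
    ring
  integral_abs_quad_le a := by
    have hprob : IsProbabilityMeasure (P.map X) := Measure.isProbabilityMeasure_map hX
    obtain ⟨hm, h⟩ := memLp_quad_and_integral_sq_le hX hiso hL a
    refine le_sqrt_of_sq_le ((sq_integral_le (f := fun y : EuclideanSpace ℝ (Fin n) =>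
      |∑ i, ∑ j, a i j * y i * y j - ∑ i, a i i|) hm.abs).trans ?_)
    simpa only [sq_abs] using h
  one_le := one_le_corrConst hX hiso hL hn

/-- Under `y ↦ -y` the integrand becomes its conjugate while the law is unchanged, so the integral
is real and only the cosine survives. -/
lemma weightedCharFun_eq_cosTransform (hX : AEMeasurable X P) [IsProbabilityMeasure P]
    (hsymm : IdentDistrib X (fun ω => -X ω) P P) (θ : EuclideanSpace ℝ (Fin n)) (t : ℝ) :
    weightedCharFun X P θ t = (cosTransform (P.map X) t θ : ℂ) := by
  have hprob : IsProbabilityMeasure (P.map X) := Measure.isProbabilityMeasure_map hX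
  set φ : EuclideanSpace ℝ (Fin n) → ℂ := fun y =>
    Complex.exp (Complex.I * (t : ℂ) * ((inner ℝ y θ : ℝ) : ℂ)) with hφ
  have hφc : Continuous φ := by fun_prop
  have hre : ∀ y, φ y = Complex.exp ((t * inner ℝ y θ : ℝ) * Complex.I) := fun y => by
    simp only [hφ]; congr 1; push_cast; ring
  have hi : Integrable φ (P.map X) := .of_bound hφc.aestronglyMeasurable 1 (ae_of_all _ fun y => by
    rw [hre, Complex.norm_exp_ofReal_mul_I])
  have h1 : weightedCharFun X P θ t = ∫ y, φ y ∂(P.map X) := by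
    rw [integral_map hX hφc.aestronglyMeasurable, weightedCharFun]
  have h2 : ∫ y, φ (-y) ∂(P.map X) = ∫ y, φ y ∂(P.map X) := by
    conv_rhs => rw [hsymm.map_eq]
    rw [integral_map (f := fun y => φ (-y)) hX (hφc.comp continuous_neg).aestronglyMeasurable,
      integral_map hsymm.aemeasurable_snd hφc.aestronglyMeasurable]
  have h3 : (starRingEnd ℂ) (∫ y, φ y ∂(P.map X)) = ∫ y, φ y ∂(P.map X) := by
    rw [← integral_conj, ← h2]
    refine integral_congr_ae (ae_of_all _ fun y => ?_)
    simp only [hφ, inner_neg_left]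
    rw [← Complex.exp_conj]
    simp
  rw [h1, ← Complex.conj_eq_iff_re.1 h3]
  congr 1
  have h4 := integral_re hi
  simp only [RCLike.re_to_complex] at h4
  rw [← h4, cosTransform]
  refine integral_congr_ae (ae_of_all _ fun y => ?_)
  simp only [hre, Complex.exp_ofReal_mul_I_re]

lemma norm_weightedCharFun_sub_meanCharFun (hX : AEMeasurable X P) [IsProbabilityMeasure P]
    (hsymm : IdentDistrib X (fun ω => -X ω) P P)
    (θ : Metric.sphere (0 : EuclideanSpace ℝ (Fin n)) 1) (t : ℝ) :
    ‖weightedCharFun X P θ t - meanCharFun X P t‖ = |sphereDev (P.map X) t θ| := by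
  simp_rw [meanCharFun, weightedCharFun_eq_cosTransform hX hsymm]
  rw [integral_complex_ofReal, ← Complex.ofReal_sub, Complex.norm_real, norm_eq_abs, sphereDev]

end Law

end WeightedSums

theorem corollary5p1 :
    ∃ c : ℝ, 0 < c ∧
      ∀ (n : ℕ), 2 ≤ n →
      ∀ (Ω : Type*) [MeasurableSpace Ω] (P : Measure Ω) [IsProbabilityMeasure P]
        (X : Ω → EuclideanSpace ℝ (Fin n)),
        AEMeasurable X P →
        WeightedSums.IsIsotropic X P →
        IdentDistrib X (fun ω => -X ω) P P →
        WeightedSums.corrConst X P < ∞ →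
        ∀ t : ℝ, 0 < |t| → |t| ≤ (n : ℝ) ^ ((1 : ℝ) / 6) →
          (Integrable (fun θ : Metric.sphere (0 : EuclideanSpace ℝ (Fin n)) 1 =>
              ‖WeightedSums.weightedCharFun X P θ t - WeightedSums.meanCharFun X P t‖ ^ 2)
              (WeightedSums.sphereUniform n) ∧
            ∫ θ : Metric.sphere (0 : EuclideanSpace ℝ (Fin n)) 1,
              ‖WeightedSums.weightedCharFun X P θ t - WeightedSums.meanCharFun X P t‖ ^ 2
              ∂(WeightedSums.sphereUniform n)
              ≤ c / (n : ℝ) ^ 2 * (WeightedSums.corrConst X P).toReal * t ^ 4) ∧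
          (Integrable (fun θ : Metric.sphere (0 : EuclideanSpace ℝ (Fin n)) 1 =>
              Real.exp ((n : ℝ) / (c * (WeightedSums.corrConst X P).toReal * t ^ 2) *
                ‖WeightedSums.weightedCharFun X P θ t - WeightedSums.meanCharFun X P t‖))
              (WeightedSums.sphereUniform n) ∧
            ∫ θ : Metric.sphere (0 : EuclideanSpace ℝ (Fin n)) 1,
              Real.exp ((n : ℝ) / (c * (WeightedSums.corrConst X P).toReal * t ^ 2) *
                ‖WeightedSums.weightedCharFun X P θ t - WeightedSums.meanCharFun X P t‖)
              ∂(WeightedSums.sphereUniform n) ≤ 2) := by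
  refine ⟨5000000000, by norm_num, ?_⟩
  intro n hn Ω _ P _ X hX hiso hsymm hL t ht htn
  have hprob : IsProbabilityMeasure (P.map X) := Measure.isProbabilityMeasure_map hX
  have hμ := WeightedSums.isSecondOrderIsotropic_map hX hiso hL hn
  have hn0 : 0 < n := by omega
  have hσ := (WeightedSums.exists_polar_stdGaussian hn0).1
  obtain ⟨h1, h2⟩ := hμ.sphereDev_bounds hn0 (abs_pos.1 ht) htn
  simp only [WeightedSums.norm_weightedCharFun_sub_meanCharFun hX hsymm, sq_abs]
  exact ⟨⟨WeightedSums.integrable_sphereDev_sq, h1⟩,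
    WeightedSums.integrable_exp_sphereDev (by positivity), h2⟩
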